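/- Let $d\ge 1$, let $B$ be a $d\times d$ matrix with integer entries and $\det B\neq 0$, let $b\in\mathbb{R}^d$, and let $T:\mathbb{T}^d\to\mathbb{T}^d$, $Tx=Bx+b \bmod \mathbb{Z}^d$, be the corresponding affine map of the torus $\mathbb{T}^d=\mathbb{R}^d/\mathbb{Z}^d$. Suppose that the topological entropy of $T$ is positive. Call a bounded sequence $(w_n)_{n\ge 0}$ of complex numbers a non-trivial weight if $\limsup_{N\to\infty}\frac1N\sum_{n=0}^{N-1}|w_n|>0$. Then $T$ is Bohr chaotic: for every non-trivial weight $(w_n)$ there exist a continuous function $f:\mathbb{T}^d\to\mathbb{C}$ and a point $x\in\mathbb{T}^d$ such that $$\limsup_{N\to\infty}\frac1N\left|\sum_{n=0}^{N-1}w_n f(T^n x)\right|>0. \qquad (*)$$ Moreover, for every non-trivial weight $(w_n)$ there is a continuous function $f:\mathbb{T}^d\to\mathbb{C}$ such that the set of points $x\in\mathbb{T}^d$ satisfying $(*)$ has Hausdorff dimension $d$. -/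

import Mathlib

open Filter

/-- A (non-trivial) weight: a bounded sequence of complex numbers with
`limsup_{N → ∞} (1 / N) * ∑_{n < N} |w n| > 0`. -/
def IsWeight (w : ℕ → ℂ) : Prop :=
  (∃ C : ℝ, ∀ n, ‖w n‖ ≤ C) ∧
    0 < limsup (fun N : ℕ => (1 / (N : ℝ)) * ∑ n ∈ Finset.range N, ‖w n‖) atTop

/-- The pair `(f, x)` is correlated to the weight `w` for the system `(X, T)`:
`limsup_{N → ∞} (1 / N) * |∑_{n < N} w n * f (T^n x)| > 0`. -/
def IsCorrelatedPair {X : Type*} [TopologicalSpace X] (T : X → X) (w : ℕ → ℂ)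
    (f : C(X, ℂ)) (x : X) : Prop :=
  0 < limsup (fun N : ℕ => (1 / (N : ℝ)) * ‖∑ n ∈ Finset.range N, w n * f (T^[n] x)‖) atTop

/-- The system `(X, T)` is Bohr chaotic: every non-trivial weight has a correlated pair. -/
def IsBohrChaotic {X : Type*} [TopologicalSpace X] (T : X → X) : Prop :=
  ∀ w : ℕ → ℂ, IsWeight w → ∃ (f : C(X, ℂ)) (x : X), IsCorrelatedPair T w f x

/-- The torus `𝕋^d = (ℝ / ℤ)^d`. Its metric is the supremum of the quotient metrics of `ℝ / ℤ`,
which is Lipschitz equivalent to the Euclidean quotient metric. -/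
abbrev Torus (d : ℕ) : Type := Fin d → UnitAddCircle

/-- The affine map `x ↦ B x + b mod ℤ^d` of the torus. -/
noncomputable def toralAffineMap {d : ℕ} (B : Matrix (Fin d) (Fin d) ℤ) (b : Fin d → ℝ) :
    Torus d → Torus d :=
  fun x i => ∑ j, B i j • x j + (b i : UnitAddCircle)

/-! If every eigenvalue of `B` had modulus at most one, the iterates of `T` would expand distances
subexponentially and the entropy would vanish (`exists_norm_pow_le`,
`coverEntropy_le_of_dist_iterate_le`). So B u = z u for some |z| > 1 and u ≠ 0. The functional φ ξ =
∑ i, ξ i * u i satisfies φ (Bᵀ ξ) = z φ ξ; hence, when φ k ≠ 0, |φ| grows geometrically along the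
frequencies ξ n = (Bᵀ)^n k. Measuring frequencies by |φ| turns the orbit of k into a lacunary
sequence.

For f = e_k, f (T^n x) is a unimodular constant times e_{ξ n}(x). Fix m with |z|^m > 4 and a residue
class r mod m along which the weight is still non-trivial. Let μ be the Riesz product ∏ (1 + δ Re
(a_j e_{ξ (m j + r)})) (`exists_riesz_measure`). Its coefficients on the class are δ/2 times conj
a_j, with a_j carrying the phase of the weight, and are at most δ²/4 on the rest of the orbit. For
small δ the weighted averages therefore have μ-means bounded below infinitely often, and dominated
convergence gives the correlated set positive μ-measure (`measure_correlated_ne_zero`).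

Testing μ against Fejér kernels bounds balls of radius r by a multiple of r^(d - η) once 1 + δ ≤
|z|^(m η) (`exists_measure_closedBall_le`). Since δ may be as small as desired while f stays fixed,
the mass distribution principle gives dimension d. -/

open MeasureTheory UnitAddTorus ComplexConjugate

/-! ### Characters and Haar measure of the torus. -/

/-- The normalised Haar measure of the torus. -/
noncomputable def torusHaar (d : ℕ) : Measure (Torus d) :=
  Measure.pi fun _ => AddCircle.haarAddCircle

instance (d : ℕ) : IsProbabilityMeasure (torusHaar d) := by
  unfold torusHaar; infer_instance

lemma integral_fourier_haarAddCircle (n : ℤ) :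
    ∫ x : UnitAddCircle, fourier n x ∂AddCircle.haarAddCircle = if n = 0 then 1 else 0 := by
  split_ifs with h
  · subst h; simp
  · exact integral_eq_zero_of_add_right_eq_neg (fourier_add_half_inv_index h Fact.out)

lemma integral_mFourier_torusHaar {d : ℕ} (ξ : Fin d → ℤ) :
    ∫ x, mFourier ξ x ∂torusHaar d = if ξ = 0 then 1 else 0 := by
  have h := integral_fintype_prod_eq_prod (𝕜 := ℂ)
    (μ := fun _ : Fin d => (AddCircle.haarAddCircle : Measure UnitAddCircle))
    (fun i x => fourier (ξ i) x)
  simp only [integral_fourier_haarAddCircle] at h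
  change ∫ x, ∏ i, fourier (ξ i) (x i) ∂torusHaar d = _
  refine h.trans ?_
  split_ifs with hξ
  · simp [hξ]
  · obtain ⟨i, hi⟩ := Function.ne_iff.mp hξ
    exact Finset.prod_eq_zero (Finset.mem_univ i) (if_neg hi)

lemma mFourier_add_right {d : ℕ} (ξ : Fin d → ℤ) (x y : Torus d) :
    mFourier ξ (x + y) = mFourier ξ x * mFourier ξ y := by
  simp [mFourier, fourier_apply, smul_add, AddCircle.toCircle_add, Finset.prod_mul_distrib]

lemma norm_mFourier_apply {d : ℕ} (ξ : Fin d → ℤ) (x : Torus d) : ‖mFourier ξ x‖ = 1 := by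
  simp only [mFourier, fourier_apply, ContinuousMap.coe_mk, norm_prod, Circle.norm_coe,
    Finset.prod_const_one]

lemma norm_fourier_one_sub_one_le (x : UnitAddCircle) :
    ‖(fourier 1 x : ℂ) - 1‖ ≤ 2 * Real.pi * ‖x‖ := by
  induction x using QuotientAddGroup.induction_on with
  | H t =>
    change ‖(fourier 1 ((t : ℝ) : UnitAddCircle) : ℂ) - 1‖ ≤
      2 * Real.pi * ‖((t : ℝ) : UnitAddCircle)‖
    have e : ((t : ℝ) : UnitAddCircle) = ((t - round t : ℝ) : UnitAddCircle) := by
      rw [AddCircle.coe_sub, eq_comm, sub_eq_self, AddCircle.coe_eq_zero_iff]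
      exact ⟨round t, by simp⟩
    rw [UnitAddCircle.norm_eq, e, fourier_coe_apply]
    have h := Real.norm_exp_I_mul_ofReal_sub_one_le (x := 2 * Real.pi * (t - round t))
    rw [Real.norm_eq_abs, abs_mul, abs_of_pos Real.two_pi_pos] at h
    convert h using 4
    push_cast
    ring

/-- Telescoping a product of unimodular factors; this later makes the Fejér kernel close to its peak
value near its centre. -/
lemma norm_mFourier_sub_one_le {d : ℕ} (ξ : Fin d → ℤ) (x : Torus d) :
    ‖mFourier ξ x - 1‖ ≤ 2 * Real.pi * ∑ i, |(ξ i : ℝ)| * ‖x i‖ := by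
  have key : ∀ s : Finset (Fin d), ‖∏ i ∈ s, (fourier (ξ i) (x i) : ℂ) - 1‖ ≤
      ∑ i ∈ s, ‖(fourier (ξ i) (x i) : ℂ) - 1‖ := by
    intro s
    induction s using Finset.induction_on with
    | empty => simp
    | insert i s hi ih =>
      rw [Finset.prod_insert hi, Finset.sum_insert hi]
      have : (fourier (ξ i) (x i) : ℂ) * ∏ i ∈ s, (fourier (ξ i) (x i) : ℂ) - 1 =
        (fourier (ξ i) (x i) : ℂ) * (∏ i ∈ s, (fourier (ξ i) (x i) : ℂ) - 1) +
          ((fourier (ξ i) (x i) : ℂ) - 1) := by ring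
      rw [this]
      refine (norm_add_le _ _).trans ?_
      rw [norm_mul, fourier_apply, Circle.norm_coe, one_mul, add_comm]
      gcongr
  refine (key _).trans ?_
  rw [Finset.mul_sum]
  gcongr with i
  have : (fourier (ξ i) (x i) : ℂ) = fourier 1 (ξ i • x i) := by simp [fourier_apply]
  rw [this]
  refine (norm_fourier_one_sub_one_le _).trans ?_
  gcongr
  exact norm_zsmul_le (n := ξ i) (a := x i)

lemma mFourier_toralAffineMap {d : ℕ} (B : Matrix (Fin d) (Fin d) ℤ) (b : Fin d → ℝ)
    (ξ : Fin d → ℤ) (x : Torus d) :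
    mFourier ξ (toralAffineMap B b x) =
      mFourier (B.transpose.mulVec ξ) x * mFourier ξ fun i => (b i : UnitAddCircle) := by
  have : toralAffineMap B b x = (fun i => ∑ j, B i j • x j) + fun i => (b i : UnitAddCircle) := rfl
  rw [this, mFourier_add_right]
  congr 1
  have hs : ∀ (s : Finset (Fin d)) (f : Fin d → UnitAddCircle),
      ((∑ j ∈ s, f j).toCircle : ℂ) = ∏ j ∈ s, ((f j).toCircle : ℂ) := by
    intro s f
    induction s using Finset.induction_on with
    | empty => simp
    | insert i s hi ih => rw [Finset.sum_insert hi, Finset.prod_insert hi, AddCircle.toCircle_add,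
        Circle.coe_mul, ih]
  change ∏ i, ((ξ i • ∑ j, B i j • x j).toCircle : ℂ) =
    ∏ j, (((∑ i, B i j * ξ i) • x j).toCircle : ℂ)
  have h₁ : ∀ i, ξ i • ∑ j, B i j • x j = ∑ j, ξ i • B i j • x j := fun i => Finset.smul_sum
  have h₂ : ∀ j, (∑ i, B i j * ξ i) • x j = ∑ i, (B i j * ξ i) • x j := fun j => Finset.sum_smul
  simp only [h₁, h₂, hs]
  rw [Finset.prod_comm]
  refine Finset.prod_congr rfl fun j _ => Finset.prod_congr rfl fun i _ => ?_
  rw [smul_smul, mul_comm]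

/-! ### Trigonometric polynomials with spectrum controlled by an additive functional. -/

section

variable {d : ℕ}

/-- Trigonometric polynomials on the torus whose frequencies `ξ` satisfy `‖φ ξ‖ ≤ R`. -/
noncomputable def trigLe (φ : (Fin d → ℤ) →+ ℂ) (R : ℝ) : Submodule ℂ C(Torus d, ℂ) :=
  Submodule.span ℂ (mFourier '' {ξ | ‖φ ξ‖ ≤ R})

section trigLe

variable {φ : (Fin d → ℤ) →+ ℂ} {R S : ℝ}

lemma mFourier_mem_trigLe {ξ : Fin d → ℤ} (h : ‖φ ξ‖ ≤ R) : mFourier ξ ∈ trigLe φ R :=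
  Submodule.subset_span ⟨ξ, h, rfl⟩

lemma one_mem_trigLe (h : 0 ≤ R) : (1 : C(Torus d, ℂ)) ∈ trigLe φ R := by
  rw [← mFourier_zero]
  exact mFourier_mem_trigLe (by simpa using h)

lemma mul_mem_trigLe {g h : C(Torus d, ℂ)} (hg : g ∈ trigLe φ R) (hh : h ∈ trigLe φ S) :
    g * h ∈ trigLe φ (R + S) := by
  unfold trigLe at hg hh
  refine Submodule.span_induction₂ (p := fun g h _ _ => g * h ∈ trigLe φ (R + S))
    ?_ ?_ ?_ ?_ ?_ ?_ ?_ hg hh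
  · rintro _ _ ⟨ξ, hξ, rfl⟩ ⟨η, hη, rfl⟩
    have : mFourier ξ * mFourier η = mFourier (ξ + η) := by
      ext x; simp [mFourier_add]
    rw [this]
    refine mFourier_mem_trigLe ?_
    rw [map_add]
    exact (norm_add_le _ _).trans (add_le_add hξ hη)
  · intro y _; simp
  · intro y _; simp
  · intro x y z _ _ _ h₁ h₂; rw [add_mul]; exact add_mem h₁ h₂
  · intro x y z _ _ _ h₁ h₂; rw [mul_add]; exact add_mem h₁ h₂
  · intro c x y _ _ h; rw [smul_mul_assoc]; exact Submodule.smul_mem _ _ h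
  · intro c x y _ _ h; rw [mul_smul_comm]; exact Submodule.smul_mem _ _ h

/-- Orthogonality: -ξ lies outside the spectrum of g. Every cancellation in the Riesz products
reduces to this. -/
lemma integral_mFourier_mul_eq_zero {g : C(Torus d, ℂ)} (hg : g ∈ trigLe φ R) {ξ : Fin d → ℤ}
    (hξ : R < ‖φ ξ‖) : ∫ x, mFourier ξ x * g x ∂torusHaar d = 0 := by
  have hint : ∀ h : C(Torus d, ℂ), Integrable (fun x => mFourier ξ x * h x) (torusHaar d) :=
    fun h => ((mFourier ξ).continuous.mul h.continuous).integrable_of_hasCompactSupport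
      (HasCompactSupport.of_compactSpace _)
  unfold trigLe at hg
  induction hg using Submodule.span_induction with
  | mem g hg =>
    obtain ⟨η, hη, rfl⟩ := hg
    simp_rw [← mFourier_add]
    rw [integral_mFourier_torusHaar, if_neg]
    intro h
    rw [← eq_neg_iff_add_eq_zero] at h
    rw [h, map_neg, norm_neg] at hξ
    exact absurd hη (not_le.mpr hξ)
  | zero => simp
  | add g h _ _ ihg ihh =>
    simp_rw [ContinuousMap.add_apply, mul_add]
    rw [integral_add (hint g) (hint h), ihg, ihh, add_zero]
  | smul c g _ ih =>
    simp_rw [ContinuousMap.smul_apply, smul_eq_mul, mul_left_comm _ c]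
    rw [integral_const_mul, ih, mul_zero]

end trigLe

/-! ### Riesz products and their weak limits. -/

/-- The factor `1 + δ Re (a e_ξ)` of a Riesz product. -/
noncomputable def rieszFactor (δ : ℝ) (a : ℂ) (ξ : Fin d → ℤ) : C(Torus d, ℂ) :=
  1 + (δ / 2 : ℂ) • (a • mFourier ξ + conj a • mFourier (-ξ))

lemma rieszFactor_apply (δ : ℝ) (a : ℂ) (ξ : Fin d → ℤ) (x : Torus d) :
    rieszFactor δ a ξ x = ((1 + δ * (a * mFourier ξ x).re : ℝ) : ℂ) := by
  simp only [rieszFactor, ContinuousMap.add_apply, ContinuousMap.smul_apply, smul_eq_mul,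
    ContinuousMap.one_apply, mFourier_neg, ← map_mul, Complex.add_conj]
  push_cast
  ring

lemma rieszFactor_mem_trigLe (φ : (Fin d → ℤ) →+ ℂ) (δ : ℝ) (a : ℂ) (ξ : Fin d → ℤ) :
    rieszFactor δ a ξ ∈ trigLe φ ‖φ ξ‖ := by
  refine add_mem (one_mem_trigLe (norm_nonneg _)) (Submodule.smul_mem _ _ (add_mem ?_ ?_)) <;>
  refine Submodule.smul_mem _ _ (mFourier_mem_trigLe ?_)
  · exact le_rfl
  · simp

/-- Partial Riesz product over the indices in a finite set. -/
noncomputable def rieszProd (δ : ℝ) (a : ℕ → ℂ) (ξ : ℕ → Fin d → ℤ) (s : Finset ℕ) :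
    C(Torus d, ℂ) :=
  ∏ j ∈ s, rieszFactor δ (a j) (ξ j)

section rieszProd

variable {δ : ℝ} {a : ℕ → ℂ} {ξ : ℕ → Fin d → ℤ}

lemma rieszProd_mem_trigLe (φ : (Fin d → ℤ) →+ ℂ) (s : Finset ℕ) :
    rieszProd δ a ξ s ∈ trigLe φ (∑ j ∈ s, ‖φ (ξ j)‖) := by
  induction s using Finset.induction_on with
  | empty => exact one_mem_trigLe (by simp)
  | insert i s hi ih =>
    rw [rieszProd, Finset.prod_insert hi, Finset.sum_insert hi]
    exact mul_mem_trigLe (rieszFactor_mem_trigLe φ _ _ _) ih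

lemma rieszProd_apply (s : Finset ℕ) (x : Torus d) :
    rieszProd δ a ξ s x = ((∏ j ∈ s, (1 + δ * (a j * mFourier (ξ j) x).re) : ℝ) : ℂ) := by
  simp [rieszProd, ContinuousMap.prod_apply, rieszFactor_apply]

lemma abs_mul_re_le (hδ : 0 ≤ δ) {c : ℂ} (hc : ‖c‖ ≤ 1) (η : Fin d → ℤ) (x : Torus d) :
    |δ * (c * mFourier η x).re| ≤ δ := by
  rw [abs_mul, abs_of_nonneg hδ]
  refine mul_le_of_le_one_right hδ ((Complex.abs_re_le_norm _).trans ?_)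
  rwa [norm_mul, norm_mFourier_apply, mul_one]

lemma rieszProd_re_nonneg (hδ : 0 ≤ δ) (hδ1 : δ ≤ 1) (ha : ∀ j, ‖a j‖ ≤ 1) (s : Finset ℕ)
    (x : Torus d) : 0 ≤ (rieszProd δ a ξ s x).re := by
  rw [rieszProd_apply, Complex.ofReal_re]
  refine Finset.prod_nonneg fun j _ => ?_
  linarith [neg_le_of_abs_le (abs_mul_re_le hδ (ha j) (ξ j) x)]

lemma rieszProd_re_le (hδ : 0 ≤ δ) (hδ1 : δ ≤ 1) (ha : ∀ j, ‖a j‖ ≤ 1) (s : Finset ℕ)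
    (x : Torus d) : (rieszProd δ a ξ s x).re ≤ (1 + δ) ^ s.card := by
  rw [rieszProd_apply, Complex.ofReal_re, ← Finset.prod_const]
  refine Finset.prod_le_prod (fun j _ => ?_) fun j _ => ?_
  · linarith [neg_le_of_abs_le (abs_mul_re_le hδ (ha j) (ξ j) x)]
  · linarith [le_of_abs_le (abs_mul_re_le hδ (ha j) (ξ j) x)]

lemma integrable_continuousMap (μ : Measure (Torus d)) [IsFiniteMeasure μ] (g : C(Torus d, ℂ)) :
    Integrable g μ :=
  g.continuous.integrable_of_hasCompactSupport (HasCompactSupport.of_compactSpace _)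

lemma integral_mul_rieszFactor (g : C(Torus d, ℂ)) (c : ℂ) (η : Fin d → ℤ) :
    ∫ x, g x * rieszFactor δ c η x ∂torusHaar d = ∫ x, g x ∂torusHaar d +
      δ / 2 * (c * ∫ x, mFourier η x * g x ∂torusHaar d +
        conj c * ∫ x, mFourier (-η) x * g x ∂torusHaar d) := by
  have h₁ := integrable_continuousMap (torusHaar d) g
  have h₂ := integrable_continuousMap (torusHaar d) (mFourier η * g)
  have h₃ := integrable_continuousMap (torusHaar d) (mFourier (-η) * g)
  have : ∀ x, g x * rieszFactor δ c η x = g x + (δ / 2 * (c * (mFourier η * g) x +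
      conj c * (mFourier (-η) * g) x)) := by
    intro x
    simp only [rieszFactor, ContinuousMap.add_apply, ContinuousMap.smul_apply, smul_eq_mul,
      ContinuousMap.one_apply, ContinuousMap.mul_apply]
    ring
  simp_rw [this]
  have e₁ : ∫ x, c * (mFourier η * g) x + conj c * (mFourier (-η) * g) x ∂torusHaar d =
      c * ∫ x, mFourier η x * g x ∂torusHaar d +
        conj c * ∫ x, mFourier (-η) x * g x ∂torusHaar d := by
    rw [integral_add (h₂.const_mul _) (h₃.const_mul _), integral_const_mul, integral_const_mul]
    rfl
  rw [← e₁, ← integral_const_mul]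
  exact integral_add h₁ (((h₂.const_mul _).add (h₃.const_mul _)).const_mul _)

/-- Multiplying by Riesz factors of large frequency does not change the integral. -/
lemma integral_mul_rieszProd_Ico {φ : (Fin d → ℤ) →+ ℂ} {R : ℝ} {g : C(Torus d, ℂ)}
    (hg : g ∈ trigLe φ R) {J : ℕ}
    (hJ : ∀ j, J ≤ j → R + ∑ i ∈ Finset.Ico J j, ‖φ (ξ i)‖ < ‖φ (ξ j)‖) (n : ℕ) :
    ∫ x, g x * rieszProd δ a ξ (Finset.Ico J (J + n)) x ∂torusHaar d = ∫ x, g x ∂torusHaar d := by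
  induction n with
  | zero => simp [rieszProd]
  | succ n ih =>
    have hmem := mul_mem_trigLe hg
      (rieszProd_mem_trigLe (δ := δ) (a := a) (ξ := ξ) φ (Finset.Ico J (J + n)))
    have hlt := hJ (J + n) (Nat.le_add_right _ _)
    have h := integral_mul_rieszFactor (δ := δ)
      (g * rieszProd δ a ξ (Finset.Ico J (J + n))) (a (J + n)) (ξ (J + n))
    rw [integral_mFourier_mul_eq_zero hmem hlt,
      integral_mFourier_mul_eq_zero hmem (by rwa [map_neg, norm_neg])] at h
    have hsucc : rieszProd δ a ξ (Finset.Ico J (J + (n + 1))) =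
        rieszProd δ a ξ (Finset.Ico J (J + n)) * rieszFactor δ (a (J + n)) (ξ (J + n)) := by
      rw [← add_assoc]
      exact Finset.prod_Ico_succ_top (Nat.le_add_right J n) _
    simp only [ContinuousMap.mul_apply, mul_zero, add_zero, ih] at h
    simpa only [hsucc, ContinuousMap.mul_apply, mul_assoc] using h

lemma integral_mFourier_mul_rieszProd_eq_zero {φ : (Fin d → ℤ) →+ ℂ} {s : Finset ℕ}
    {η : Fin d → ℤ} (h : ∑ i ∈ s, ‖φ (ξ i)‖ < ‖φ η‖) :
    ∫ x, mFourier η x * rieszProd δ a ξ s x ∂torusHaar d = 0 :=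
  integral_mFourier_mul_eq_zero (rieszProd_mem_trigLe φ s) h

lemma integral_mFourier_mul_rieszProd_succ (n : ℕ) (η : Fin d → ℤ) :
    ∫ x, mFourier η x * rieszProd δ a ξ (Finset.range (n + 1)) x ∂torusHaar d =
      ∫ x, mFourier η x * rieszProd δ a ξ (Finset.range n) x ∂torusHaar d +
      δ / 2 * (a n * ∫ x, mFourier (ξ n + η) x * rieszProd δ a ξ (Finset.range n) x ∂torusHaar d +
        conj (a n) *
          ∫ x, mFourier (-ξ n + η) x * rieszProd δ a ξ (Finset.range n) x ∂torusHaar d) := by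
  have h := integral_mul_rieszFactor (δ := δ)
    (mFourier η * rieszProd δ a ξ (Finset.range n)) (a n) (ξ n)
  have hsucc : rieszProd δ a ξ (Finset.range (n + 1)) =
      rieszProd δ a ξ (Finset.range n) * rieszFactor δ (a n) (ξ n) :=
    Finset.prod_range_succ _ _
  simpa only [hsucc, ContinuousMap.mul_apply, mFourier_add, mul_assoc] using h

/-- The Fourier coefficients of a dissociate Riesz product. -/
lemma integral_mFourier_mul_rieszProd {φ : (Fin d → ℤ) →+ ℂ} (hδ : 0 ≤ δ) (hδ1 : δ ≤ 1)
    (ha : ∀ j, ‖a j‖ ≤ 1)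
    (hφ : ∀ j, 2 * ∑ i ∈ Finset.range j, ‖φ (ξ i)‖ < ‖φ (ξ j)‖) (n : ℕ) :
    ∫ x, mFourier 0 x * rieszProd δ a ξ (Finset.range n) x ∂torusHaar d = 1 ∧
    (∀ η, η ≠ 0 →
      ‖∫ x, mFourier η x * rieszProd δ a ξ (Finset.range n) x ∂torusHaar d‖ ≤ δ / 2) ∧
    (∀ j < n, ∫ x, mFourier (ξ j) x * rieszProd δ a ξ (Finset.range n) x ∂torusHaar d =
      δ / 2 * conj (a j)) ∧
    ∀ η, η ≠ 0 → (∀ j, η ≠ ξ j ∧ η ≠ -ξ j) →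
      ‖∫ x, mFourier η x * rieszProd δ a ξ (Finset.range n) x ∂torusHaar d‖ ≤ δ ^ 2 / 4 := by
  induction n with
  | zero =>
    have h0 : ∀ η : Fin d → ℤ,
        ∫ x, mFourier η x * rieszProd δ a ξ (Finset.range 0) x ∂torusHaar d =
          if η = 0 then 1 else 0 := by
      intro η
      simpa [rieszProd] using integral_mFourier_torusHaar η
    refine ⟨by rw [h0, if_pos rfl], fun η hη => ?_, fun j hj => absurd hj (Nat.not_lt_zero _),
      fun η hη _ => ?_⟩ <;> rw [h0, if_neg hη, norm_zero] <;> positivity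
  | succ n ih =>
    obtain ⟨ih0, ih1, ih2, ih3⟩ := ih
    set I : (Fin d → ℤ) → ℂ :=
      fun η => ∫ x, mFourier η x * rieszProd δ a ξ (Finset.range n) x ∂torusHaar d with hI
    have hsucc := integral_mFourier_mul_rieszProd_succ (δ := δ) (a := a) (ξ := ξ) n
    have hzero : ∀ η, ∑ i ∈ Finset.range n, ‖φ (ξ i)‖ < ‖φ η‖ → I η = 0 := fun η h =>
      integral_mFourier_mul_rieszProd_eq_zero h
    change I 0 = 1 at ih0
    change ∀ η, _ → ‖I η‖ ≤ _ at ih1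
    change ∀ j < n, I (ξ j) = _ at ih2
    change ∀ η, _ → _ → ‖I η‖ ≤ _ at ih3
    change ∀ η, _ = I η + δ / 2 * (a n * I (ξ n + η) + conj (a n) * I (-ξ n + η)) at hsucc
    set R := ∑ i ∈ Finset.range n, ‖φ (ξ i)‖ with hR
    have hR0 : 0 ≤ R := Finset.sum_nonneg fun _ _ => norm_nonneg _
    have hn := hφ n
    rw [← hR] at hn
    -- Since |φ (ξ n)| > 2R, shifting a frequency of size at most R by ±ξ n leaves the spectrum of
    -- the partial product.
    have hlow : ∀ η, ‖φ η‖ ≤ R → I (ξ n + η) = 0 ∧ I (-ξ n + η) = 0 := by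
      intro η hη
      constructor <;> apply hzero <;> rw [map_add]
      · have := norm_sub_norm_le (φ (ξ n)) (-φ η)
        rw [sub_neg_eq_add, norm_neg] at this
        linarith
      · have := norm_sub_norm_le (φ (ξ n)) (φ η)
        rw [map_neg, neg_add_eq_sub, norm_sub_rev]
        linarith
    -- The windows of φ-radius R around 0, ξ n and -ξ n are disjoint, so at most one of the three
    -- terms of the recursion survives and the bounds never accumulate with n.
    have htri : ∀ η, ∫ x, mFourier η x * rieszProd δ a ξ (Finset.range (n + 1)) x ∂torusHaar d =
        I η ∨
        ∫ x, mFourier η x * rieszProd δ a ξ (Finset.range (n + 1)) x ∂torusHaar d =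
          δ / 2 * (a n * I (ξ n + η)) ∨
        ∫ x, mFourier η x * rieszProd δ a ξ (Finset.range (n + 1)) x ∂torusHaar d =
          δ / 2 * (conj (a n) * I (-ξ n + η)) := by
      intro η
      simp only [hsucc]
      rcases le_or_gt ‖φ η‖ R with h | h
      · left; simp [hlow η h]
      · right
        rw [hzero η h]
        rcases le_or_gt ‖φ (ξ n + η)‖ R with h' | h'
        · left
          have := (hlow _ h').2
          rw [hzero (-ξ n + η)]
          · ring
          · have e : -ξ n + η = (ξ n + η) - (ξ n + ξ n) := by abel
            rw [e, map_sub, map_add φ (ξ n) (ξ n)]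
            have h1 := norm_sub_norm_le (φ (ξ n) + φ (ξ n)) (φ (ξ n + η))
            rw [← two_mul, norm_mul, Complex.norm_ofNat, norm_sub_rev] at h1
            rw [← two_mul]
            linarith
        · right
          rw [hzero _ h']
          ring
    have hb : ∀ η, ‖I η‖ ≤ 1 := by
      intro η
      by_cases h : η = 0
      · simp [h, ih0]
      · linarith [ih1 η h]
    have hmul : ∀ (c z : ℂ) (t : ℝ), ‖c‖ ≤ 1 → ‖z‖ ≤ t → ‖(δ / 2 : ℂ) * (c * z)‖ ≤ δ / 2 * t := by
      intro c z t hc hz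
      have : ‖(δ / 2 : ℂ)‖ = δ / 2 := by
        rw [norm_div, Complex.norm_real, Real.norm_of_nonneg hδ, Complex.norm_ofNat]
      rw [norm_mul, norm_mul, this]
      gcongr
      exact (mul_le_of_le_one_left (norm_nonneg _) hc).trans hz
    refine ⟨?_, fun η hη => ?_, fun j hj => ?_, fun η hη hη' => ?_⟩
    · rw [hsucc, (hlow 0 (by simpa using hR0)).1, (hlow 0 (by simpa using hR0)).2, ih0]
      ring
    · rcases htri η with h | h | h <;> rw [h]
      · exact ih1 η hη
      · simpa using hmul _ _ 1 (ha n) (hb (ξ n + η))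
      · simpa using hmul (conj (a n)) _ 1 (by simpa using ha n) (hb (-ξ n + η))
    · rcases Nat.lt_succ_iff_lt_or_eq.mp hj with hj | rfl
      · have hjR : ‖φ (ξ j)‖ ≤ R := Finset.single_le_sum (f := fun i => ‖φ (ξ i)‖)
          (fun _ _ => norm_nonneg _) (Finset.mem_range.mpr hj)
        rw [hsucc, (hlow _ hjR).1, (hlow _ hjR).2, ih2 j hj]
        ring
      -- The newest frequency is seen only through the conjugate term, whose shifted frequency is 0
      -- and whose integral is therefore 1.
      · have h2 : I (ξ j + ξ j) = 0 := by
          apply hzero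
          rw [map_add, ← two_mul, norm_mul, Complex.norm_ofNat]
          linarith
        rw [hsucc, hzero (ξ j) (by linarith), h2, neg_add_cancel, ih0]
        ring
    -- As η ≠ ±ξ n, a surviving shifted term has non-zero frequency: one factor δ/2 is from the new
    -- Riesz factor, the other from the general bound.
    · have e : δ ^ 2 / 4 = δ / 2 * (δ / 2) := by ring
      rcases htri η with h | h | h <;> rw [h]
      · exact ih3 η hη hη'
      · rw [e]
        refine hmul _ _ _ (ha n) (ih1 _ fun h0 => (hη' n).2 ?_)
        rwa [add_comm, ← eq_neg_iff_add_eq_zero] at h0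
      · rw [e]
        refine hmul _ _ _ (by simpa using ha n) (ih1 _ fun h0 => (hη' n).1 ?_)
        rwa [neg_add_eq_zero, eq_comm] at h0

end rieszProd

/-- The partial product is a density: it is non-negative because δ ≤ 1, and its total mass is its
zeroth Fourier coefficient. -/
lemma exists_probabilityMeasure_rieszProd {δ : ℝ} {a : ℕ → ℂ} {ξ : ℕ → Fin d → ℤ}
    {φ : (Fin d → ℤ) →+ ℂ} (hδ : 0 ≤ δ) (hδ1 : δ ≤ 1) (ha : ∀ j, ‖a j‖ ≤ 1)
    (hφ : ∀ j, 2 * ∑ i ∈ Finset.range j, ‖φ (ξ i)‖ < ‖φ (ξ j)‖) (n : ℕ) :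
    ∃ μ : ProbabilityMeasure (Torus d), ∀ g : C(Torus d, ℂ),
      ∫ x, g x ∂(μ : Measure (Torus d)) =
        ∫ x, g x * rieszProd δ a ξ (Finset.range n) x ∂torusHaar d := by
  set P := rieszProd δ a ξ (Finset.range n) with hP
  have hre : ∀ x, ((P x).re : ℂ) = P x := fun x => by
    rw [hP, rieszProd_apply, Complex.ofReal_re]
  have hnn : ∀ x, 0 ≤ (P x).re := rieszProd_re_nonneg hδ hδ1 ha _
  have hmeas : Measurable fun x => ENNReal.ofReal (P x).re := by
    have : Continuous fun x => (P x).re := Complex.continuous_re.comp P.continuous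
    exact this.measurable.ennreal_ofReal
  have hint : ∀ g : Torus d → ℂ, ∫ x, g x ∂(torusHaar d).withDensity
      (fun x => ENNReal.ofReal (P x).re) = ∫ x, g x * P x ∂torusHaar d := by
    intro g
    rw [integral_withDensity_eq_integral_toReal_smul hmeas (by simp)]
    refine integral_congr_ae (Eventually.of_forall fun x => ?_)
    simp only [ENNReal.toReal_ofReal (hnn x), Complex.real_smul, hre, mul_comm]
  have hone : ∫ x, P x ∂torusHaar d = 1 := by
    simpa [mFourier_zero] using (integral_mFourier_mul_rieszProd hδ hδ1 ha hφ n).1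
  refine ⟨⟨(torusHaar d).withDensity fun x => ENNReal.ofReal (P x).re, ⟨?_⟩⟩, fun g => hint g⟩
  rw [withDensity_apply _ MeasurableSet.univ, Measure.restrict_univ]
  simp only [← RCLike.re_eq_complex_re] at hnn ⊢
  rw [← ofReal_integral_eq_lintegral_ofReal (integrable_continuousMap _ P).re
      (Eventually.of_forall hnn)]
  have : ∫ x, RCLike.re (P x) ∂torusHaar d = 1 := by
    rw [integral_re (integrable_continuousMap (torusHaar d) P), hone, RCLike.one_re]
  rw [this, ENNReal.ofReal_one]

/-- A Riesz product measure, as a weak limit of the partial products. -/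
theorem exists_riesz_measure {δ : ℝ} {a : ℕ → ℂ} {ξ : ℕ → Fin d → ℤ}
    {φ : (Fin d → ℤ) →+ ℂ} (hδ : 0 ≤ δ) (hδ1 : δ ≤ 1) (ha : ∀ j, ‖a j‖ ≤ 1)
    (hφ : ∀ j, 2 * ∑ i ∈ Finset.range j, ‖φ (ξ i)‖ < ‖φ (ξ j)‖) :
    ∃ μ : Measure (Torus d), IsProbabilityMeasure μ ∧
      (∀ j, ∫ x, mFourier (ξ j) x ∂μ = δ / 2 * conj (a j)) ∧
      (∀ η, η ≠ 0 → (∀ j, η ≠ ξ j ∧ η ≠ -ξ j) → ‖∫ x, mFourier η x ∂μ‖ ≤ δ ^ 2 / 4) ∧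
      ∀ (J : ℕ) (R : ℝ) (g : C(Torus d, ℂ)), g ∈ trigLe φ R →
        (∀ j, J ≤ j → R + ∑ i ∈ Finset.Ico J j, ‖φ (ξ i)‖ < ‖φ (ξ j)‖) →
        (∀ x, 0 ≤ (g x).re ∧ (g x).im = 0) →
        (∫ x, g x ∂μ).re ≤ (1 + δ) ^ J * (∫ x, g x ∂torusHaar d).re := by
  choose ν hν using exists_probabilityMeasure_rieszProd hδ hδ1 ha hφ
  -- Compactness of the space of probability measures, used along an ultrafilter in place of a
  -- subsequence.
  obtain ⟨μ, hμ⟩ : ∃ μ, Tendsto ν ((hyperfilter ℕ : Ultrafilter ℕ) : Filter ℕ) (nhds μ) := by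
    obtain ⟨μ, -, h⟩ := isCompact_univ (X := ProbabilityMeasure (Torus d)).ultrafilter_le_nhds
      ((hyperfilter ℕ).map ν) (by simp)
    exact ⟨μ, h⟩
  have hle : ((hyperfilter ℕ : Ultrafilter ℕ) : Filter ℕ) ≤ atTop := Nat.hyperfilter_le_atTop
  rw [ProbabilityMeasure.tendsto_iff_forall_integral_rclike_tendsto ℂ] at hμ
  have hlim : ∀ g : C(Torus d, ℂ), Tendsto
      (fun n => ∫ x, g x * rieszProd δ a ξ (Finset.range n) x ∂torusHaar d)
      ((hyperfilter ℕ : Ultrafilter ℕ) : Filter ℕ) (nhds (∫ x, g x ∂(μ : Measure (Torus d)))) := by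
    intro g
    have := hμ (BoundedContinuousFunction.mkOfCompact g)
    simpa only [BoundedContinuousFunction.mkOfCompact_apply, hν] using this
  have hcoef := integral_mFourier_mul_rieszProd hδ hδ1 ha hφ
  refine ⟨μ, inferInstance, fun j => ?_, fun η hη hη' => ?_, fun J R g hg hJ hpos => ?_⟩
  · refine tendsto_nhds_unique (hlim (mFourier (ξ j))) (tendsto_const_nhds.congr' ?_)
    filter_upwards [hle (eventually_gt_atTop j)] with n hn
    exact ((hcoef n).2.2.1 j hn).symm
  · exact le_of_tendsto (hlim (mFourier η)).norm
      (Eventually.of_forall fun n => (hcoef n).2.2.2 η hη hη')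
  · refine le_of_tendsto ((Complex.continuous_re.tendsto _).comp (hlim g)) ?_
    filter_upwards [hle (eventually_ge_atTop J)] with n hn
    obtain ⟨m, rfl⟩ := Nat.exists_eq_add_of_le hn
    -- The first J factors are bounded pointwise by (1 + δ)^J; the remaining ones do not change the
    -- integral of g.
    have hsplit : rieszProd δ a ξ (Finset.range (J + m)) =
        rieszProd δ a ξ (Finset.range J) * rieszProd δ a ξ (Finset.Ico J (J + m)) :=
      (Finset.prod_range_mul_prod_Ico _ hn).symm
    have htail := integral_mul_rieszProd_Ico (δ := δ) (a := a) hg hJ m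
    set Q := rieszProd δ a ξ (Finset.Ico J (J + m)) with hQ
    set P := rieszProd δ a ξ (Finset.range J) with hP
    have hQn : ∀ x, 0 ≤ (Q x).re := rieszProd_re_nonneg hδ hδ1 ha _
    have hPim : ∀ x, (P x).im = 0 := fun x => by rw [hP, rieszProd_apply, Complex.ofReal_im]
    have hPle : ∀ x, (P x).re ≤ (1 + δ) ^ J := fun x => by
      simpa using rieszProd_re_le (ξ := ξ) hδ hδ1 ha (Finset.range J) x
    have hi₁ := integrable_continuousMap (torusHaar d) (g * (P * Q))
    have hi₂ := integrable_continuousMap (torusHaar d) (g * Q)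
    have e₁ : (∫ x, g x * (P * Q) x ∂torusHaar d).re = ∫ x, (g x * (P * Q) x).re ∂torusHaar d :=
      (integral_re hi₁).symm
    have e₂ : (∫ x, g x * Q x ∂torusHaar d).re = ∫ x, (g x * Q x).re ∂torusHaar d :=
      (integral_re hi₂).symm
    rw [Function.comp_apply, hsplit, e₁, ← htail, e₂, ← integral_const_mul]
    refine integral_mono hi₁.re (hi₂.re.const_mul _) fun x => ?_
    simp only [ContinuousMap.mul_apply, Complex.mul_re, Complex.mul_im,
      hPim, (hpos x).2, zero_mul, sub_zero]
    nlinarith [mul_nonneg (hpos x).1 (hQn x), hPle x]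

/-! ### Hausdorff dimension and the mass of balls. -/

/-- Mass distribution principle. -/
theorem le_dimH_of_measure_closedBall_le {X : Type*} [MetricSpace X] [MeasurableSpace X]
    [BorelSpace X] {μ : Measure X} {s : NNReal} {K r₀ : ℝ} (hK : 0 < K) (hr₀ : 0 < r₀)
    (h : ∀ y r, 0 < r → r ≤ r₀ → μ (Metric.closedBall y r) ≤ ENNReal.ofReal (K * r ^ (s : ℝ)))
    {E : Set X} (hE : μ E ≠ 0) : (s : ENNReal) ≤ dimH E := by
  have key : (ENNReal.ofReal K)⁻¹ • μ ≤ μH[(s : ℝ)] := by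
    refine Measure.le_hausdorffMeasure _ _ (ENNReal.ofReal (r₀ / 2)) (by simpa using hr₀)
      fun t ht => ?_
    rcases t.eq_empty_or_nonempty with rfl | ⟨y, hy⟩
    · simp
    have hfin : Metric.ediam t ≠ ⊤ := ne_top_of_le_ne_top ENNReal.ofReal_ne_top ht
    have hD : Metric.diam t < r₀ := by
      have := ENNReal.toReal_le_of_le_ofReal (by positivity) ht
      unfold Metric.diam
      linarith
    -- The ball estimate needs a positive radius, whereas the diameter may be 0; hence radii
    -- decreasing to the diameter.
    have hlim : Tendsto (fun r : ℝ => ENNReal.ofReal (K * r ^ (s : ℝ)))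
        (nhdsWithin (Metric.diam t) (Set.Ioi (Metric.diam t)))
        (nhds (ENNReal.ofReal (K * Metric.diam t ^ (s : ℝ)))) := by
      refine ENNReal.tendsto_ofReal (Tendsto.const_mul _ ?_)
      exact ((Real.continuous_rpow_const s.coe_nonneg).tendsto _).mono_left nhdsWithin_le_nhds
    have hle : μ t ≤ ENNReal.ofReal (K * Metric.diam t ^ (s : ℝ)) := by
      refine ge_of_tendsto hlim ?_
      filter_upwards [Ioc_mem_nhdsGT hD] with r hr
      refine (measure_mono ?_).trans (h y r (Metric.diam_nonneg.trans_lt hr.1) hr.2)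
      intro z hz
      exact (Metric.dist_le_diam_of_mem (Metric.isBounded_iff_ediam_ne_top.mpr hfin) hz hy).trans
        hr.1.le
    rw [Measure.smul_apply, smul_eq_mul, mul_comm, ← div_eq_mul_inv]
    refine ENNReal.div_le_of_le_mul (hle.trans_eq ?_)
    rw [ENNReal.ofReal_mul hK.le, ← ENNReal.ofReal_rpow_of_nonneg Metric.diam_nonneg s.coe_nonneg,
      Metric.diam, ENNReal.ofReal_toReal hfin, mul_comm]
  refine le_dimH_of_hausdorffMeasure_ne_zero fun h0 => ?_
  have := key E
  rw [h0, Measure.smul_apply, smul_eq_mul, nonpos_iff_eq_zero, mul_eq_zero,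
    ENNReal.inv_eq_zero] at this
  exact this.elim ENNReal.ofReal_ne_top hE

lemma dimH_torus_le (d : ℕ) (E : Set (Torus d)) : dimH E ≤ d := by
  have hl : LipschitzWith 1 fun (x : Fin d → ℝ) (i : Fin d) => ((x i : ℝ) : UnitAddCircle) := by
    refine LipschitzWith.of_dist_le_mul fun x y => ?_
    rw [NNReal.coe_one, one_mul, dist_pi_le_iff dist_nonneg]
    intro i
    refine le_trans ?_ (dist_le_pi_dist x y i)
    rw [dist_eq_norm, dist_eq_norm, ← AddCircle.coe_sub, UnitAddCircle.norm_eq, Real.norm_eq_abs]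
    simpa using round_le (x i - y i) 0
  have hs : Function.Surjective fun (x : Fin d → ℝ) (i : Fin d) => ((x i : ℝ) : UnitAddCircle) := by
    intro x
    choose f hf using fun i => QuotientAddGroup.mk_surjective (x i)
    exact ⟨f, funext hf⟩
  calc dimH E ≤ dimH (Set.range fun (x : Fin d → ℝ) (i : Fin d) => ((x i : ℝ) : UnitAddCircle)) :=
        dimH_mono (by rw [hs.range_eq]; exact Set.subset_univ _)
    _ ≤ dimH (Set.univ : Set (Fin d → ℝ)) := hl.dimH_range_le
    _ = d := Real.dimH_univ_pi_fin d

lemma norm_map_le_sum (φ : (Fin d → ℤ) →+ ℂ) {ξ : Fin d → ℤ} {M : ℝ}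
    (h : ∀ i, |(ξ i : ℝ)| ≤ M) : ‖φ ξ‖ ≤ M * ∑ i, ‖φ (Pi.single i 1)‖ := by
  have : φ ξ = ∑ i, (ξ i : ℂ) * φ (Pi.single i 1) := by
    have := LinearMap.pi_apply_eq_sum_univ φ.toIntLinearMap ξ
    have e : ∀ i : Fin d, (fun j => if i = j then (1 : ℤ) else 0) = Pi.single i 1 := by
      intro i; ext j; simp [Pi.single_apply, eq_comm]
    simpa [e] using this
  rw [this, Finset.mul_sum]
  refine norm_sum_le_of_le _ fun i _ => ?_
  rw [norm_mul]
  gcongr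
  simpa using h i

/-- A Fejér-type kernel on the torus. -/
lemma exists_fejer_kernel (φ : (Fin d → ℤ) →+ ℂ) {M : ℕ} (hM : 0 < M) (y : Torus d) :
    ∃ g : C(Torus d, ℂ), g ∈ trigLe φ (2 * (M * ∑ i, ‖φ (Pi.single i 1)‖)) ∧
      (∀ x, 0 ≤ (g x).re ∧ (g x).im = 0) ∧ ∫ x, g x ∂torusHaar d = ((M : ℂ) ^ d)⁻¹ ∧
      ∀ x, 4 * Real.pi * d * M * dist x y ≤ 1 → 1 / 4 ≤ (g x).re := by
  set e : (Fin d → Fin M) → (Fin d → ℤ) := fun m i => ((m i : ℕ) : ℤ) with he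
  have he_inj : Function.Injective e := by
    intro m m' h
    ext i
    simpa [e] using congrFun h i
  have hle : ∀ m i, |(e m i : ℝ)| ≤ M := fun m i => by
    simp [e]
  set c : ℂ := ((M : ℂ) ^ d)⁻¹ with hc
  have hMC : (M : ℂ) ^ d ≠ 0 := pow_ne_zero _ (by exact_mod_cast hM.ne')
  have hcard : (Fintype.card (Fin d → Fin M) : ℂ) = (M : ℂ) ^ d := by simp
  have hcc : conj c = c := by simp [hc]
  -- Dirichlet kernel of the cube {0, …, M - 1}^d centred at y, normalised to equal 1 there; the
  -- required kernel is |D|².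
  set D : C(Torus d, ℂ) := ∑ m, (c * conj (mFourier (e m) y)) • mFourier (e m) with hD
  set D' : C(Torus d, ℂ) := ∑ m, (c * mFourier (e m) y) • mFourier (-e m) with hD'
  have hDD' : ∀ x, D' x = conj (D x) := by
    intro x
    simp [hD, hD', ContinuousMap.sum_apply, mFourier_neg, hcc]
  have hDx : ∀ x, D x = c * ∑ m, mFourier (e m) (x - y) := by
    intro x
    simp only [hD, ContinuousMap.sum_apply, ContinuousMap.smul_apply, smul_eq_mul, Finset.mul_sum]
    refine Finset.sum_congr rfl fun m _ => ?_
    have h1 : mFourier (e m) x = mFourier (e m) (x - y) * mFourier (e m) y := by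
      rw [← mFourier_add_right, sub_add_cancel]
    have h2 : mFourier (e m) y * conj (mFourier (e m) y) = 1 := by
      rw [Complex.mul_conj, Complex.normSq_eq_norm_sq, norm_mFourier_apply]; simp
    rw [h1]
    linear_combination c * mFourier (e m) (x - y) * h2
  have hgx : ∀ x, (D * D') x = ((‖D x‖ ^ 2 : ℝ) : ℂ) := by
    intro x
    rw [ContinuousMap.mul_apply, hDD', Complex.mul_conj, Complex.normSq_eq_norm_sq]
  refine ⟨D * D', ?_, fun x => ?_, ?_, fun x hx => ?_⟩
  · rw [two_mul]
    refine mul_mem_trigLe (Submodule.sum_mem _ fun m _ => Submodule.smul_mem _ _ ?_)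
      (Submodule.sum_mem _ fun m _ => Submodule.smul_mem _ _ ?_) <;>
    refine mFourier_mem_trigLe ?_
    · exact norm_map_le_sum φ (hle m)
    · rw [map_neg, norm_neg]
      exact norm_map_le_sum φ (hle m)
  · rw [hgx, Complex.ofReal_re, Complex.ofReal_im]
    exact ⟨by positivity, rfl⟩
  · have hexp : ∀ x, (D * D') x = ∑ m, ∑ m', (c * conj (mFourier (e m) y)) *
        (c * mFourier (e m') y) * mFourier (e m + -e m') x := by
      intro x
      simp only [hD, hD', ContinuousMap.mul_apply, ContinuousMap.sum_apply,
        ContinuousMap.smul_apply, smul_eq_mul, Finset.sum_mul_sum, mFourier_add]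
      refine Finset.sum_congr rfl fun m _ => Finset.sum_congr rfl fun m' _ => by ring
    simp_rw [hexp]
    have hi : ∀ m m', Integrable (fun x => (c * conj (mFourier (e m) y)) *
        (c * mFourier (e m') y) * mFourier (e m + -e m') x) (torusHaar d) := fun m m' =>
      (integrable_continuousMap _ _).const_mul _
    rw [integral_finsetSum _ fun m _ => integrable_finsetSum _ fun m' _ => hi m m']
    have hterm : ∀ m, ∫ x, ∑ m', (c * conj (mFourier (e m) y)) *
        (c * mFourier (e m') y) * mFourier (e m + -e m') x ∂torusHaar d = c ^ 2 := by
      intro m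
      rw [integral_finsetSum _ fun m' _ => hi m m', Finset.sum_eq_single m]
      · rw [integral_const_mul, integral_mFourier_torusHaar, if_pos (add_neg_cancel _)]
        have h2 : mFourier (e m) y * conj (mFourier (e m) y) = 1 := by
          rw [Complex.mul_conj, Complex.normSq_eq_norm_sq, norm_mFourier_apply]; simp
        linear_combination c ^ 2 * h2
      · intro m' _ hm
        rw [integral_const_mul, integral_mFourier_torusHaar, if_neg, mul_zero]
        rw [← sub_eq_add_neg, sub_eq_zero]
        exact fun h => hm (he_inj h).symm
      · simp
    -- Only the M^d diagonal terms contribute, each c² with c = M^(-d).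
    rw [Finset.sum_congr rfl fun m _ => hterm m, Finset.sum_const, Finset.card_univ, nsmul_eq_mul,
      hcard, hc]
    field_simp
  · rw [hgx, Complex.ofReal_re]
    have h1 : ‖D x - 1‖ ≤ 1 / 2 := by
      have : D x - 1 = c * ∑ m, (mFourier (e m) (x - y) - 1) := by
        rw [hDx, Finset.sum_sub_distrib, Finset.sum_const, Finset.card_univ, nsmul_eq_mul, hcard,
          mul_one, mul_sub, hc, inv_mul_cancel₀ hMC]
      rw [this, norm_mul]
      have h2 : ‖∑ m, (mFourier (e m) (x - y) - 1)‖ ≤ ∑ _m : Fin d → Fin M, (1 / 2 : ℝ) := by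
        refine norm_sum_le_of_le _ fun m _ => (norm_mFourier_sub_one_le _ _).trans ?_
        have h3 : ∑ i, |(e m i : ℝ)| * ‖(x - y) i‖ ≤ ∑ _i : Fin d, (M * dist x y : ℝ) := by
          refine Finset.sum_le_sum fun i _ => ?_
          gcongr
          · exact hle m i
          · rw [dist_eq_norm]; exact norm_le_pi_norm (x - y) i
        rw [Finset.sum_const, Finset.card_univ, Fintype.card_fin, nsmul_eq_mul] at h3
        have := mul_le_mul_of_nonneg_left h3 Real.two_pi_pos.le
        linarith
      rw [Finset.sum_const, Finset.card_univ, nsmul_eq_mul] at h2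
      have hcard' : (Fintype.card (Fin d → Fin M) : ℝ) = (M : ℝ) ^ d := by simp
      rw [hcard'] at h2
      have hMR : (0 : ℝ) < (M : ℝ) ^ d := by positivity
      have hcn : ‖c‖ = ((M : ℝ) ^ d)⁻¹ := by simp [hc]
      rw [hcn, inv_mul_le_iff₀ hMR]
      exact h2
    have h4 := norm_sub_norm_le (1 : ℂ) (D x)
    rw [norm_one, norm_sub_rev] at h4
    nlinarith

/-- Ratio 4 leaves a third of the next term: enough for dissociateness, with room for the spectrum
of a Fejér kernel. -/
lemma sum_Ico_geom_le {Λ : ℝ} (hΛ : 4 ≤ Λ) (J j : ℕ) :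
    3 * ∑ i ∈ Finset.Ico J j, Λ ^ i ≤ Λ ^ j := by
  rcases le_or_gt J j with h | h
  · induction j, h using Nat.le_induction with
    | base => simp; positivity
    | succ n hn ih =>
      rw [Finset.sum_Ico_succ_top hn, pow_succ]
      have : (0 : ℝ) ≤ Λ ^ n := by positivity
      nlinarith
  · rw [Finset.Ico_eq_empty_of_le h.le, Finset.sum_empty, mul_zero]
    positivity

/-- Hölder regularity of measures dominated by lacunary Riesz products. -/
theorem exists_measure_closedBall_le (hd : 0 < d) {φ : (Fin d → ℤ) →+ ℂ} {ξ : ℕ → Fin d → ℤ}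
    {c Λ q η : ℝ} (hc : 0 < c) (hΛ : 4 ≤ Λ) (hφ : ∀ j, ‖φ (ξ j)‖ = c * Λ ^ j)
    (hq : 0 ≤ q) (hqη : q ≤ Λ ^ η) (hη : 0 ≤ η) (hηd : η ≤ d)
    {μ : Measure (Torus d)} [IsProbabilityMeasure μ]
    (hμ : ∀ (J : ℕ) (R : ℝ) (g : C(Torus d, ℂ)), g ∈ trigLe φ R →
        (∀ j, J ≤ j → R + ∑ i ∈ Finset.Ico J j, ‖φ (ξ i)‖ < ‖φ (ξ j)‖) →
        (∀ x, 0 ≤ (g x).re ∧ (g x).im = 0) →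
        (∫ x, g x ∂μ).re ≤ q ^ J * (∫ x, g x ∂torusHaar d).re) :
    ∃ K r₀ : ℝ, 0 < K ∧ 0 < r₀ ∧ ∀ y r, 0 < r → r ≤ r₀ →
      μ (Metric.closedBall y r) ≤ ENNReal.ofReal (K * r ^ ((d : ℝ) - η)) := by
  set U := ∑ i, ‖φ (Pi.single i 1)‖ with hU
  have hU0 : 0 ≤ U := Finset.sum_nonneg fun _ _ => norm_nonneg _
  -- With this A, Λ^j > A M forces the kernel's φ-radius 2 M U below a quarter of c Λ^j; the earlier
  -- frequencies use at most a third more.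
  set A := max 1 (8 * U / c) with hA
  have hA1 : 1 ≤ A := le_max_left _ _
  have hdR : (0 : ℝ) < d := by exact_mod_cast hd
  set r₀ := (4 * Real.pi * d)⁻¹ with hr₀
  have hr₀0 : 0 < r₀ := by positivity
  have hΛ0 : 0 < Λ := by linarith
  refine ⟨4 * (Λ * A) ^ η * (2 / r₀) ^ ((d : ℝ) - η), r₀, by positivity, hr₀0,
    fun y r hr hrr => ?_⟩
  -- Largest degree for which the kernel is still at least 1/4 on the whole ball of radius r.
  set M := ⌊r₀ / r⌋₊ with hM
  have hM1 : 1 ≤ M := Nat.one_le_floor_iff _ |>.mpr ((one_le_div hr).mpr hrr)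
  have hM1R : (1 : ℝ) ≤ M := by exact_mod_cast hM1
  have hMle : (M : ℝ) ≤ r₀ / r := Nat.floor_le (by positivity)
  have hMge : r₀ / (2 * r) ≤ M := by
    have := Nat.lt_floor_add_one (r₀ / r)
    rw [← hM] at this
    have e : r₀ / (2 * r) = r₀ / r / 2 := by field_simp
    rw [e]
    linarith
  -- Λ^n ≤ A M < Λ^(n+1): the factors from index n + 1 on are invisible to the kernel, and the first
  -- n + 1 cost q^(n+1), of order M^η.
  obtain ⟨n, hn1, hn2⟩ := exists_nat_pow_near (x := A * M) (y := Λ) (by nlinarith) (by linarith)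
  obtain ⟨g, hg, hpos, hint, hball⟩ := exists_fejer_kernel φ hM1 y
  have hlac : ∀ j, n + 1 ≤ j →
      2 * (M * U) + ∑ i ∈ Finset.Ico (n + 1) j, ‖φ (ξ i)‖ < ‖φ (ξ j)‖ := by
    intro j hj
    simp_rw [hφ]
    rw [← Finset.mul_sum]
    have h1 := sum_Ico_geom_le hΛ (n + 1) j
    have h2 : Λ ^ (n + 1) ≤ Λ ^ j := pow_le_pow_right₀ (by linarith) hj
    have h3 : 8 * U ≤ c * A := by
      have := le_max_right 1 (8 * U / c)
      rw [← hA, div_le_iff₀ hc] at this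
      linarith
    have h4 : 8 * U * M ≤ c * A * M := by gcongr
    have h5 : c * (A * M) < c * Λ ^ j := by gcongr; linarith
    have h6 : c * (3 * ∑ i ∈ Finset.Ico (n + 1) j, Λ ^ i) ≤ c * Λ ^ j := by gcongr
    have h7 : 0 < c * Λ ^ j := by positivity
    linarith
  have h := hμ (n + 1) _ g hg hlac hpos
  have hre : (∫ x, g x ∂torusHaar d).re = ((M : ℝ) ^ d)⁻¹ := by
    rw [hint, ← Complex.ofReal_natCast, ← Complex.ofReal_pow, ← Complex.ofReal_inv,
      Complex.ofReal_re]
  rw [hre] at h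
  have hreal : μ.real (Metric.closedBall y r) ≤ 4 * (∫ x, g x ∂μ).re := by
    have hre' : (∫ x, g x ∂μ).re = ∫ x, (g x).re ∂μ :=
      (integral_re (integrable_continuousMap μ g)).symm
    rw [hre', ← integral_const_mul,
      ← integral_indicator_one Metric.isClosed_closedBall.measurableSet]
    refine integral_mono ((integrable_const 1).indicator Metric.isClosed_closedBall.measurableSet)
      ((integrable_continuousMap μ g).re.const_mul _) fun x => ?_
    change _ ≤ 4 * (g x).re
    by_cases hx : x ∈ Metric.closedBall y r
    · rw [Set.indicator_of_mem hx]
      have hb : 4 * Real.pi * d * M * dist x y ≤ 1 := by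
        have h1 : (M : ℝ) * dist x y ≤ r₀ / r * r :=
          mul_le_mul hMle hx dist_nonneg (by positivity)
        rw [div_mul_cancel₀ _ hr.ne', hr₀] at h1
        calc 4 * Real.pi * d * M * dist x y = 4 * Real.pi * d * (M * dist x y) := by ring
          _ ≤ 4 * Real.pi * d * (4 * Real.pi * d)⁻¹ := by gcongr
          _ = 1 := mul_inv_cancel₀ (by positivity)
      have := hball x hb
      simp only [Pi.one_apply]
      linarith
    · rw [Set.indicator_of_notMem hx]
      linarith [(hpos x).1]
  rw [← ofReal_measureReal]
  refine ENNReal.ofReal_le_ofReal (hreal.trans ?_)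
  have hqJ : q ^ (n + 1) ≤ (Λ * A) ^ η * (M : ℝ) ^ η := by
    calc q ^ (n + 1) ≤ (Λ ^ η) ^ (n + 1) := by gcongr
      _ = (Λ ^ (n + 1)) ^ η := by
        rw [← Real.rpow_natCast, ← Real.rpow_mul hΛ0.le, mul_comm, Real.rpow_mul hΛ0.le,
          Real.rpow_natCast]
      _ ≤ (Λ * A * M) ^ η := by
        refine Real.rpow_le_rpow (by positivity) ?_ hη
        rw [pow_succ]
        nlinarith
      _ = _ := Real.mul_rpow (by positivity) (by positivity)
  have hMd : (M : ℝ) ^ η * ((M : ℝ) ^ d)⁻¹ ≤ (2 / r₀) ^ ((d : ℝ) - η) * r ^ ((d : ℝ) - η) := by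
    rw [← Real.mul_rpow (by positivity) hr.le, ← Real.rpow_natCast, ← Real.rpow_neg (by positivity),
      ← Real.rpow_add (by positivity), show η + -(d : ℝ) = -((d : ℝ) - η) by ring,
      Real.rpow_neg (by positivity), ← Real.inv_rpow (by positivity)]
    refine Real.rpow_le_rpow (by positivity) ?_ (by linarith)
    rw [inv_le_comm₀ (by positivity) (by positivity)]
    refine le_trans (le_of_eq ?_) hMge
    field_simp
  calc 4 * (∫ x, g x ∂μ).re ≤ 4 * (q ^ (n + 1) * ((M : ℝ) ^ d)⁻¹) := by gcongr
    _ ≤ 4 * ((Λ * A) ^ η * (M : ℝ) ^ η * ((M : ℝ) ^ d)⁻¹) := by gcongr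
    _ = 4 * (Λ * A) ^ η * ((M : ℝ) ^ η * ((M : ℝ) ^ d)⁻¹) := by ring
    _ ≤ 4 * (Λ * A) ^ η * ((2 / r₀) ^ ((d : ℝ) - η) * r ^ ((d : ℝ) - η)) := by gcongr
    _ = _ := by ring

/-! ### Positive entropy forces an eigenvalue outside the unit disc. -/

lemma exists_grid_dist_le {N : ℕ} (hN : 0 < N) (x : Torus d) :
    ∃ m : Fin d → Fin N,
      dist x (fun i => (((m i : ℕ) / N : ℝ) : UnitAddCircle)) ≤ 1 / N := by
  have hNR : (0 : ℝ) < N := by exact_mod_cast hN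
  have key : ∀ z : UnitAddCircle, ∃ m : Fin N,
      dist z (((m : ℕ) / N : ℝ) : UnitAddCircle) ≤ 1 / N := by
    intro z
    obtain ⟨t, rfl⟩ := QuotientAddGroup.mk_surjective z
    have e : ((t : ℝ) : UnitAddCircle) = ((Int.fract t : ℝ) : UnitAddCircle) := by
      rw [← Int.self_sub_floor, AddCircle.coe_sub, eq_comm, sub_eq_self, AddCircle.coe_eq_zero_iff]
      exact ⟨⌊t⌋, by simp⟩
    have h0 : 0 ≤ Int.fract t * N := mul_nonneg (Int.fract_nonneg t) hNR.le
    have h1 : Int.fract t * N < N := by nlinarith [Int.fract_lt_one t]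
    refine ⟨⟨⌊Int.fract t * N⌋₊, (Nat.floor_lt h0).mpr h1⟩, ?_⟩
    change dist ((t : ℝ) : UnitAddCircle) _ ≤ _
    rw [e, dist_eq_norm, ← AddCircle.coe_sub, UnitAddCircle.norm_eq]
    refine (round_le _ 0).trans ?_
    have h2 := Nat.floor_le h0
    have h3 := Nat.lt_floor_add_one (Int.fract t * N)
    have e2 : Int.fract t - (⌊Int.fract t * N⌋₊ : ℝ) / N - (0 : ℤ) =
        (Int.fract t * N - ⌊Int.fract t * N⌋₊) / N := by
      field_simp; simp
    rw [e2, abs_of_nonneg (div_nonneg (by linarith) hNR.le)]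
    gcongr
    linarith
  choose m hm using fun i => key (x i)
  exact ⟨m, (dist_pi_le_iff (by positivity)).mpr hm⟩

/-- A grid of mesh comparable to ε / K^n shadows all orbits up to time n within ε, and has on the
order of K^(d n) points. -/
lemma coverEntropy_le_of_dist_iterate_le (T : Torus d → Torus d) {K C : ℝ} (hK : 1 ≤ K)
    (hC : 0 ≤ C) (h : ∀ n x y, dist (T^[n] x) (T^[n] y) ≤ C * K ^ n * dist x y) :
    Dynamics.coverEntropy T Set.univ ≤ ENNReal.log (ENNReal.ofReal (K ^ d)) := by
  refine iSup₂_le fun U hU => ?_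
  obtain ⟨ε, hε, hεU⟩ := Metric.mem_uniformity_dist.mp hU
  set A := 2 * C / ε + 2 with hA
  have hcount : ∀ n, ((Dynamics.coverMincard T Set.univ U n : ℕ∞) : ENNReal) ≤
      ENNReal.ofReal (A ^ d) * (ENNReal.ofReal (K ^ d)) ^ n := by
    intro n
    have hKn : 1 ≤ K ^ n := one_le_pow₀ hK
    set N := ⌈2 * C * K ^ n / ε⌉₊ + 1 with hN
    have hNR : (0 : ℝ) < N := by positivity
    have hle : (N : ℝ) ≤ A * K ^ n := by
      have h1 := (Nat.ceil_lt_add_one (a := 2 * C * K ^ n / ε) (by positivity)).le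
      have e : 2 * C / ε * K ^ n = 2 * C * K ^ n / ε := by ring
      rw [hN, hA, add_mul, e]
      push_cast
      linarith
    have hge : 2 * C * K ^ n ≤ N * ε := by
      have h1 := Nat.le_ceil (2 * C * K ^ n / ε)
      rw [← div_le_iff₀ hε, hN]
      push_cast
      linarith
    classical
    set s : Finset (Torus d) := Finset.univ.image
      fun (m : Fin d → Fin N) (i : Fin d) => (((m i : ℕ) / N : ℝ) : UnitAddCircle) with hs
    have hcov : Dynamics.IsDynCoverOf T Set.univ U n (s : Set (Torus d)) := by
      intro x _
      obtain ⟨m, hm⟩ := exists_grid_dist_le (N := N) (Nat.succ_pos _) x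
      refine ⟨_, Finset.mem_coe.mpr (Finset.mem_image_of_mem _ (Finset.mem_univ m)), ?_⟩
      rw [Dynamics.mem_dynEntourage]
      intro k hk
      refine hεU ?_
      refine (h k x _).trans_lt ?_
      have hKk : K ^ k ≤ K ^ n := pow_le_pow_right₀ hK hk.le
      calc C * K ^ k * dist x _ ≤ C * K ^ n * (1 / N) := by gcongr
        _ = C * K ^ n / N := by ring
        _ < ε := by
          rw [div_lt_iff₀ hNR]
          nlinarith [mul_pos hNR hε]
    have hcard : s.card ≤ N ^ d := by
      refine Finset.card_image_le.trans (le_of_eq ?_)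
      simp
    calc ((Dynamics.coverMincard T Set.univ U n : ℕ∞) : ENNReal)
        ≤ (((s.card : ℕ) : ℕ∞) : ENNReal) := by
          exact_mod_cast hcov.coverMincard_le_card
      _ ≤ ((N ^ d : ℕ) : ENNReal) := by
          rw [ENat.toENNReal_coe]
          exact_mod_cast hcard
      _ = ENNReal.ofReal ((N : ℝ) ^ d) := by
          rw [← Nat.cast_pow, ENNReal.ofReal_natCast]
      _ ≤ ENNReal.ofReal ((A * K ^ n) ^ d) := by gcongr
      _ = _ := by
          rw [← ENNReal.ofReal_pow (by positivity), ← ENNReal.ofReal_mul (by positivity), mul_pow,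
            ← pow_mul, ← pow_mul, mul_comm n d]
  refine (ExpGrowth.expGrowthSup_le_of_eventually_le ENNReal.ofReal_ne_top
    (Eventually.of_forall hcount)).trans_eq ?_
  exact ExpGrowth.expGrowthSup_pow

lemma toralAffineMap_iterate_sub (B : Matrix (Fin d) (Fin d) ℤ) (b : Fin d → ℝ) (n : ℕ)
    (x y : Torus d) (i : Fin d) :
    (toralAffineMap B b)^[n] x i - (toralAffineMap B b)^[n] y i =
      ∑ j, (B ^ n) i j • (x j - y j) := by
  induction n generalizing i with
  | zero => simp [Matrix.one_apply]
  | succ n ih =>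
    rw [Function.iterate_succ_apply', Function.iterate_succ_apply']
    simp only [toralAffineMap, add_sub_add_right_eq_sub, ← Finset.sum_sub_distrib, ← smul_sub]
    have h₁ : ∀ k, B i k • ∑ j, (B ^ n) k j • (x j - y j) =
        ∑ j, (B i k * (B ^ n) k j) • (x j - y j) := fun k => by
      rw [Finset.smul_sum]
      exact Finset.sum_congr rfl fun j _ => smul_smul _ _ _
    have h₂ : ∀ j, (B ^ (n + 1)) i j • (x j - y j) =
        ∑ k, (B i k * (B ^ n) k j) • (x j - y j) := fun j => by
      rw [pow_succ', Matrix.mul_apply, Finset.sum_smul]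
    rw [Finset.sum_congr rfl fun k _ => (congrArg (B i k • ·) (ih k)).trans (h₁ k),
      Finset.sum_comm]
    exact Finset.sum_congr rfl fun j _ => (h₂ j).symm

section

attribute [local instance] Matrix.linftyOpNormedRing Matrix.linftyOpNormedAlgebra

lemma dist_toralAffineMap_iterate_le (B : Matrix (Fin d) (Fin d) ℤ) (b : Fin d → ℝ) (n : ℕ)
    (x y : Torus d) :
    dist ((toralAffineMap B b)^[n] x) ((toralAffineMap B b)^[n] y) ≤
      ‖(B.map (Int.cast : ℤ → ℂ)) ^ n‖ * dist x y := by
  rw [dist_pi_le_iff (by positivity)]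
  intro i
  rw [dist_eq_norm, toralAffineMap_iterate_sub]
  have hmap : (B.map (Int.cast : ℤ → ℂ)) ^ n = (B ^ n).map (Int.cast : ℤ → ℂ) :=
    (map_pow (Int.castRingHom ℂ).mapMatrix B n).symm
  have hrow : ∑ j, |((B ^ n) i j : ℝ)| ≤ ‖(B.map (Int.cast : ℤ → ℂ)) ^ n‖ := by
    rw [hmap, Matrix.linfty_opNorm_def]
    have h := Finset.le_sup (f := fun i => ∑ j, ‖((B ^ n).map (Int.cast : ℤ → ℂ)) i j‖₊)
      (Finset.mem_univ i)
    have h' := NNReal.coe_le_coe.mpr h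
    push_cast at h'
    simpa using h'
  refine le_trans ?_ (mul_le_mul_of_nonneg_right hrow dist_nonneg)
  rw [Finset.sum_mul]
  refine norm_sum_le_of_le _ fun j _ => ?_
  refine (norm_zsmul_le (n := (B ^ n) i j) (a := x j - y j)).trans ?_
  rw [← dist_eq_norm]
  exact mul_le_mul_of_nonneg_left (dist_le_pi_dist x y j) (abs_nonneg _)

/-- Powers of a matrix with spectral radius at most one grow subexponentially. -/
lemma exists_norm_pow_le (A : Matrix (Fin d) (Fin d) ℂ)
    (hA : ∀ z ∈ spectrum ℂ A, ‖z‖ ≤ 1) {K : ℝ} (hK : 1 < K) :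
    ∃ C : ℝ, 0 ≤ C ∧ ∀ n : ℕ, ‖A ^ n‖ ≤ C * K ^ n := by
  have hr : spectralRadius ℂ A < ENNReal.ofReal K := by
    refine lt_of_le_of_lt (b := 1) (iSup₂_le fun z hz => ?_) (by simpa using hK)
    exact_mod_cast hA z hz
  -- Gelfand's formula handles large n; the finitely many other powers are absorbed into the
  -- constant.
  have hev := (spectrum.pow_norm_pow_one_div_tendsto_nhds_spectralRadius A).eventually_lt_const hr
  obtain ⟨n₀, hn₀⟩ := eventually_atTop.mp (hev.and (eventually_gt_atTop 0))
  refine ⟨1 + ∑ n ∈ Finset.range n₀, ‖A ^ n‖, by positivity, fun n => ?_⟩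
  have hKn : 1 ≤ K ^ n := one_le_pow₀ hK.le
  have hs : 0 ≤ ∑ n ∈ Finset.range n₀, ‖A ^ n‖ := Finset.sum_nonneg fun _ _ => norm_nonneg _
  rcases lt_or_ge n n₀ with h | h
  · have h1 := Finset.single_le_sum (f := fun n => ‖A ^ n‖) (fun _ _ => norm_nonneg _)
      (Finset.mem_range.mpr h)
    nlinarith
  · obtain ⟨h1, h2⟩ := hn₀ n h
    have h3 := (ENNReal.ofReal_lt_ofReal_iff (by linarith)).mp h1
    have h4 : ‖A ^ n‖ ≤ K ^ n := by
      have h5 := pow_le_pow_left₀ (by positivity) h3.le n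
      rwa [one_div, Real.rpow_inv_natCast_pow (norm_nonneg _) h2.ne'] at h5
    nlinarith

lemma exists_eigenvector_of_coverEntropy_pos (B : Matrix (Fin d) (Fin d) ℤ) (b : Fin d → ℝ)
    (h : 0 < Dynamics.coverEntropy (toralAffineMap B b) Set.univ) :
    ∃ (z : ℂ) (u : Fin d → ℂ), 1 < ‖z‖ ∧ u ≠ 0 ∧ (B.map (Int.cast : ℤ → ℂ)).mulVec u = z • u := by
  by_contra! hcon
  have hsp : ∀ z ∈ spectrum ℂ (B.map (Int.cast : ℤ → ℂ)), ‖z‖ ≤ 1 := by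
    intro z hz
    by_contra! hz1
    rw [← Matrix.spectrum_toLin', ← Module.End.hasEigenvalue_iff_mem_spectrum] at hz
    obtain ⟨u, hu⟩ := hz.exists_hasEigenvector
    exact hcon z u hz1 hu.2 (by simpa using hu.apply_eq_smul)
  -- The entropy is at most d log K for every K > 1; let K decrease to 1.
  refine h.not_ge (ge_of_tendsto (x := nhdsWithin (1 : ℝ) (Set.Ioi 1))
    (f := fun K : ℝ => ENNReal.log (ENNReal.ofReal (K ^ d))) ?_ ?_)
  · have hc : Continuous fun K : ℝ => ENNReal.log (ENNReal.ofReal (K ^ d)) :=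
      ENNReal.continuous_log.comp (ENNReal.continuous_ofReal.comp (continuous_pow d))
    have := (hc.tendsto 1).mono_left (nhdsWithin_le_nhds (s := Set.Ioi 1))
    simpa using this
  · filter_upwards [self_mem_nhdsWithin] with K hK
    obtain ⟨C, hC, hCn⟩ := exists_norm_pow_le _ hsp hK
    refine coverEntropy_le_of_dist_iterate_le _ (le_of_lt hK) hC fun n x y => ?_
    exact (dist_toralAffineMap_iterate_le B b n x y).trans
      (mul_le_mul_of_nonneg_right (hCn n) dist_nonneg)

end

/-! ### Characters along orbits and weighted averages. -/

lemma limsup_pos_iff_exists_frequently {f : ℕ → ℝ} {C : ℝ} (h0 : ∀ n, 0 ≤ f n)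
    (hC : ∀ n, f n ≤ C) : 0 < limsup f atTop ↔ ∃ ε > 0, ∃ᶠ n in atTop, ε < f n := by
  have hb : IsBoundedUnder (· ≤ ·) atTop f := isBoundedUnder_of ⟨C, hC⟩
  have hcb : IsCoboundedUnder (· ≤ ·) atTop f :=
    (isBoundedUnder_of (r := (· ≥ ·)) ⟨0, h0⟩).isCoboundedUnder_le
  constructor
  · intro h
    exact ⟨limsup f atTop / 2, half_pos h, frequently_lt_of_lt_limsup hcb (half_lt_self h)⟩
  · rintro ⟨ε, hε, h⟩
    exact hε.trans_le (le_limsup_of_frequently_le (h.mono fun _ h => h.le) hb)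

lemma exists_mFourier_iterate (B : Matrix (Fin d) (Fin d) ℤ) (b : Fin d → ℝ) (k : Fin d → ℤ) :
    ∃ c : ℕ → ℂ, (∀ n, ‖c n‖ = 1) ∧ ∀ n x, mFourier k ((toralAffineMap B b)^[n] x) =
      c n * mFourier (B.transpose.mulVec^[n] k) x := by
  have : ∀ n, ∃ c : ℂ, ‖c‖ = 1 ∧ ∀ x, mFourier k ((toralAffineMap B b)^[n] x) =
      c * mFourier (B.transpose.mulVec^[n] k) x := by
    intro n
    induction n with
    | zero => exact ⟨1, by simp, by simp⟩
    | succ n ih =>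
      obtain ⟨c, hc, h⟩ := ih
      refine ⟨c * mFourier (B.transpose.mulVec^[n] k) fun i => (b i : UnitAddCircle), ?_, ?_⟩
      · rw [norm_mul, hc, norm_mFourier_apply, one_mul]
      · intro x
        rw [Function.iterate_succ_apply, h, mFourier_toralAffineMap, Function.iterate_succ_apply']
        ring
  choose c hc using this
  exact ⟨c, fun n => (hc n).1, fun n => (hc n).2⟩

/-- The additive functional `ξ ↦ ∑ i, ξ i * u i` on frequencies. -/
noncomputable def freqFunctional (u : Fin d → ℂ) : (Fin d → ℤ) →+ ℂ where
  toFun ξ := ∑ i, (ξ i : ℂ) * u i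
  map_zero' := by simp
  map_add' ξ η := by simp [add_mul, Finset.sum_add_distrib]

lemma freqFunctional_iterate {B : Matrix (Fin d) (Fin d) ℤ} {u : Fin d → ℂ} {z : ℂ}
    (hu : (B.map (Int.cast : ℤ → ℂ)).mulVec u = z • u) (k : Fin d → ℤ) (n : ℕ) :
    freqFunctional u (B.transpose.mulVec^[n] k) = z ^ n * freqFunctional u k := by
  have hstep : ∀ ξ, freqFunctional u (B.transpose.mulVec ξ) = z * freqFunctional u ξ := by
    intro ξ
    have h : ∀ j, ∑ i, (B j i : ℂ) * u i = z * u j := fun j => by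
      simpa [Matrix.mulVec, dotProduct] using congrFun hu j
    simp only [freqFunctional, AddMonoidHom.coe_mk, ZeroHom.coe_mk, Matrix.mulVec, dotProduct,
      Matrix.transpose_apply, Int.cast_sum, Int.cast_mul, Finset.sum_mul, Finset.mul_sum]
    rw [Finset.sum_comm]
    refine Finset.sum_congr rfl fun j _ => ?_
    rw [mul_left_comm, ← h j, Finset.mul_sum]
    exact Finset.sum_congr rfl fun i _ => by ring
  induction n with
  | zero => simp
  | succ n ih => rw [Function.iterate_succ_apply', hstep, ih, pow_succ]; ring

lemma weighted_average_le {w : ℕ → ℂ} {C : ℝ} (hC : ∀ n, ‖w n‖ ≤ C) {f : ℕ → ℂ}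
    (hf : ∀ n, ‖f n‖ ≤ 1) (N : ℕ) :
    1 / (N : ℝ) * ‖∑ n ∈ Finset.range N, w n * f n‖ ≤ C := by
  have hC0 : 0 ≤ C := (norm_nonneg _).trans (hC 0)
  rcases N.eq_zero_or_pos with rfl | hN
  · simpa using hC0
  have hNR : (0 : ℝ) < N := by exact_mod_cast hN
  rw [one_div, inv_mul_le_iff₀ hNR]
  refine (norm_sum_le_of_le (f := fun n => w n * f n) (n := fun _ => C) _ fun n _ => ?_).trans_eq
    (by simp)
  rw [norm_mul]
  exact (mul_le_of_le_one_right (norm_nonneg _) (hf n)).trans (hC n)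

/-- A non-trivial weight is non-trivial along some residue class. -/
lemma exists_residue_frequently {w : ℕ → ℂ} (hw : IsWeight w) {m : ℕ} (hm : 0 < m) :
    ∃ r < m, ∃ ε > 0, ∃ᶠ N : ℕ in atTop,
      ε < 1 / (N : ℝ) * ∑ n ∈ (Finset.range N).filter (· % m = r), ‖w n‖ := by
  obtain ⟨⟨C, hC⟩, hlim⟩ := hw
  rw [limsup_pos_iff_exists_frequently (C := C) (fun N => by positivity) fun N => ?_] at hlim
  · obtain ⟨ε, hε, h⟩ := hlim
    by_contra! hcon
    have hmR : (0 : ℝ) < m := by exact_mod_cast hm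
    -- Pigeonhole: if each class eventually contributed at most ε / m, the full average could not
    -- exceed ε infinitely often.
    have hall : ∀ᶠ N : ℕ in atTop, ∀ r ∈ Finset.range m,
        1 / (N : ℝ) * ∑ n ∈ (Finset.range N).filter (· % m = r), ‖w n‖ ≤ ε / m := by
      rw [eventually_all_finset]
      intro r hr
      have := hcon r (Finset.mem_range.mp hr) (ε / m) (by positivity)
      simpa using this
    obtain ⟨N, h1, h2⟩ := (h.and_eventually hall).exists
    have hsum : ∑ r ∈ Finset.range m, ∑ n ∈ (Finset.range N).filter (· % m = r), ‖w n‖ =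
        ∑ n ∈ Finset.range N, ‖w n‖ :=
      Finset.sum_fiberwise_of_maps_to (fun n _ => Finset.mem_range.mpr (Nat.mod_lt n hm)) _
    rw [← hsum, Finset.mul_sum] at h1
    have h3 := Finset.sum_le_sum h2
    rw [Finset.sum_const, Finset.card_range, nsmul_eq_mul, mul_div_cancel₀ _ hmR.ne'] at h3
    linarith
  · have := weighted_average_le (w := fun n => (‖w n‖ : ℂ)) (f := fun _ => 1) (C := C)
      (by simpa using hC) (by simp) N
    have hn : 0 ≤ ∑ n ∈ Finset.range N, ‖w n‖ := Finset.sum_nonneg fun _ _ => norm_nonneg _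
    simp only [mul_one, ← Complex.ofReal_sum, Complex.norm_real, Real.norm_of_nonneg hn] at this
    exact this

/-- If the averages have frequently large means, then the correlated set has positive measure. -/
lemma measure_correlated_ne_zero {T : Torus d → Torus d} {w : ℕ → ℂ} {C : ℝ}
    (hC : ∀ n, ‖w n‖ ≤ C) {f : C(Torus d, ℂ)} (hf : ∀ x, ‖f x‖ ≤ 1)
    (hcont : ∀ n, Continuous fun x => f (T^[n] x)) {μ : Measure (Torus d)}
    [IsProbabilityMeasure μ] {ε : ℝ} (hε : 0 < ε)
    (h : ∃ᶠ N : ℕ in atTop,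
      ε ≤ 1 / (N : ℝ) * ‖∑ n ∈ Finset.range N, w n * ∫ x, f (T^[n] x) ∂μ‖) :
    μ {x | IsCorrelatedPair T w f x} ≠ 0 := by
  intro h0
  set Y : ℕ → Torus d → ℝ := fun N x =>
    1 / (N : ℝ) * ‖∑ n ∈ Finset.range N, w n * f (T^[n] x)‖ with hY
  have hY0 : ∀ N x, 0 ≤ Y N x := fun N x => by positivity
  have hYC : ∀ N x, Y N x ≤ C := fun N x => weighted_average_le hC (fun n => hf _) N
  have hsc : ∀ N, Continuous fun x => ∑ n ∈ Finset.range N, w n * f (T^[n] x) := fun N =>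
    continuous_finsetSum _ fun n _ => continuous_const.mul (hcont n)
  have hYc : ∀ N, Continuous (Y N) := fun N => continuous_const.mul (hsc N).norm
  have hae : ∀ᵐ x ∂μ, Tendsto (fun N => Y N x) atTop (nhds 0) := by
    filter_upwards [compl_mem_ae_iff.mpr h0] with x hx
    change ¬ (0 < limsup (fun N => Y N x) atTop) at hx
    rw [limsup_pos_iff_exists_frequently (fun N => hY0 N x) (fun N => hYC N x)] at hx
    push Not at hx
    rw [Metric.tendsto_nhds]
    intro η hη
    filter_upwards [hx (η / 2) (half_pos hη)] with N hN
    rw [Real.dist_0_eq_abs, abs_of_nonneg (hY0 N x)]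
    linarith
  have hlim : Tendsto (fun N => ∫ x, Y N x ∂μ) atTop (nhds (∫ _, (0 : ℝ) ∂μ)) :=
    tendsto_integral_of_dominated_convergence (fun _ => C)
      (fun N => (hYc N).aestronglyMeasurable) (integrable_const C)
      (fun N => Eventually.of_forall fun x => by
        rw [Real.norm_of_nonneg (hY0 N x)]; exact hYC N x) hae
  rw [integral_zero] at hlim
  obtain ⟨N, h1, h2⟩ := (h.and_eventually (hlim.eventually_lt_const hε)).exists
  have hi : ∀ n, Integrable (fun x => f (T^[n] x)) μ := fun n =>
    (hcont n).integrable_of_hasCompactSupport (HasCompactSupport.of_compactSpace _)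
  have h3 : ∑ n ∈ Finset.range N, w n * ∫ x, f (T^[n] x) ∂μ =
      ∫ x, ∑ n ∈ Finset.range N, w n * f (T^[n] x) ∂μ := by
    rw [integral_finsetSum _ fun n _ => (hi n).const_mul _]
    exact Finset.sum_congr rfl fun n _ => (integral_const_mul _ _).symm
  have h4 : 1 / (N : ℝ) * ‖∑ n ∈ Finset.range N, w n * ∫ x, f (T^[n] x) ∂μ‖ ≤
      ∫ x, Y N x ∂μ := by
    rw [h3, hY]
    simp only
    rw [integral_const_mul]
    exact mul_le_mul_of_nonneg_left (norm_integral_le_integral_norm _) (by positivity)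
  linarith

/-- On the class all terms are aligned and the gain is linear in δ; off it the loss is quadratic, so
small δ wins. -/
lemma norm_sum_ge_of_residue {v : ℕ → ℂ} {w : ℕ → ℂ} {C δ : ℝ} {m r : ℕ}
    (hC : ∀ n, ‖w n‖ ≤ C) (h₁ : ∀ n, n % m = r → w n * v n = ((δ / 2 * ‖w n‖ : ℝ) : ℂ))
    (h₂ : ∀ n, n % m ≠ r → ‖v n‖ ≤ δ ^ 2 / 4) (N : ℕ) :
    δ / 2 * (1 / (N : ℝ) * ∑ n ∈ (Finset.range N).filter (· % m = r), ‖w n‖) - δ ^ 2 / 4 * C ≤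
      1 / (N : ℝ) * ‖∑ n ∈ Finset.range N, w n * v n‖ := by
  have hC0 : 0 ≤ C := (norm_nonneg _).trans (hC 0)
  rcases N.eq_zero_or_pos with rfl | hN
  · simp; positivity
  have hNR : (0 : ℝ) < N := by exact_mod_cast hN
  have hsplit := Finset.sum_filter_add_sum_filter_not (Finset.range N) (· % m = r)
    (fun n => w n * v n)
  have hmain : ∑ n ∈ (Finset.range N).filter (· % m = r), w n * v n =
      ((δ / 2 * ∑ n ∈ (Finset.range N).filter (· % m = r), ‖w n‖ : ℝ) : ℂ) := by
    rw [Finset.mul_sum, Complex.ofReal_sum]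
    exact Finset.sum_congr rfl fun n hn => h₁ n (Finset.mem_filter.mp hn).2
  have herr : ‖∑ n ∈ (Finset.range N).filter (¬ · % m = r), w n * v n‖ ≤ N * (C * (δ ^ 2 / 4)) := by
    calc _ ≤ ∑ n ∈ (Finset.range N).filter (¬ · % m = r), C * (δ ^ 2 / 4) := by
          refine norm_sum_le_of_le _ fun n hn => ?_
          rw [norm_mul]
          exact mul_le_mul (hC n) (h₂ n (Finset.mem_filter.mp hn).2) (norm_nonneg _) hC0
      _ ≤ _ := by
          rw [Finset.sum_const, nsmul_eq_mul]
          gcongr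
          simpa using Finset.card_filter_le (Finset.range N) (¬ · % m = r)
  have hge : δ / 2 * ∑ n ∈ (Finset.range N).filter (· % m = r), ‖w n‖ - N * (C * (δ ^ 2 / 4)) ≤
      ‖∑ n ∈ Finset.range N, w n * v n‖ := by
    rw [← hsplit, hmain]
    have h3 := norm_sub_norm_le
      ((δ / 2 * ∑ n ∈ (Finset.range N).filter (· % m = r), ‖w n‖ : ℝ) : ℂ)
      (-∑ n ∈ (Finset.range N).filter (¬ · % m = r), w n * v n)
    rw [sub_neg_eq_add, norm_neg, Complex.norm_real] at h3
    have h4 := Real.le_norm_self (δ / 2 * ∑ n ∈ (Finset.range N).filter (· % m = r), ‖w n‖)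
    linarith
  calc _ = 1 / (N : ℝ) * (δ / 2 * ∑ n ∈ (Finset.range N).filter (· % m = r), ‖w n‖ -
        N * (C * (δ ^ 2 / 4))) := by field_simp
    _ ≤ _ := by gcongr

lemma continuous_toralAffineMap (B : Matrix (Fin d) (Fin d) ℤ) (b : Fin d → ℝ) :
    Continuous (toralAffineMap B b) :=
  continuous_pi fun _ => (continuous_finsetSum _ fun j _ =>
    (continuous_zsmul _).comp (continuous_apply j)).add continuous_const

/-! ### Dimension of the correlated set. -/

theorem dimH_correlated_eq {B : Matrix (Fin d) (Fin d) ℤ} (b : Fin d → ℝ) {u : Fin d → ℂ} {z : ℂ}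
    (hz : 1 < ‖z‖) (hu : (B.map (Int.cast : ℤ → ℂ)).mulVec u = z • u) {k : Fin d → ℤ}
    (hk : freqFunctional u k ≠ 0) (hd : 0 < d) {w : ℕ → ℂ} (hw : IsWeight w) :
    dimH {x : Torus d | IsCorrelatedPair (toralAffineMap B b) w (mFourier k) x} = d := by
  refine le_antisymm (dimH_torus_le d _) ?_
  refine ENNReal.le_of_forall_nnreal_lt fun s hs => ?_
  have hsd : (s : ℝ) < d := by exact_mod_cast hs
  obtain ⟨m, hm⟩ := pow_unbounded_of_one_lt 4 hz
  have hm0 : 0 < m := by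
    rcases m.eq_zero_or_pos with rfl | h
    · norm_num at hm
    · exact h
  set Λ := ‖z‖ ^ m with hΛ
  obtain ⟨r, hrm, ε, hε, hfreq⟩ := exists_residue_frequently hw hm0
  obtain ⟨⟨C, hC⟩, -⟩ := hw
  have hC0 : 0 ≤ C := (norm_nonneg _).trans (hC 0)
  obtain ⟨c, hc, hiter⟩ := exists_mFourier_iterate B b k
  set ξ : ℕ → Fin d → ℤ := fun n => B.transpose.mulVec^[n] k with hξ
  set φ := freqFunctional u with hφ
  have hφξ : ∀ n, ‖φ (ξ n)‖ = ‖z‖ ^ n * ‖φ k‖ := fun n => by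
    rw [hφ, hξ, freqFunctional_iterate hu, norm_mul, norm_pow]
  have hφk : 0 < ‖φ k‖ := norm_pos_iff.mpr hk
  have hz0 : 0 < ‖z‖ := by linarith
  have hlac : ∀ j, ‖φ (ξ (m * j + r))‖ = ‖z‖ ^ r * ‖φ k‖ * Λ ^ j := fun j => by
    rw [hφξ, hΛ, ← pow_mul, pow_add]; ring
  set κ := ‖z‖ ^ r * ‖φ k‖ with hκ
  have hκ0 : 0 < κ := by positivity
  set η : ℝ := d - s with hη
  have hη0 : 0 < η := by rw [hη]; linarith
  have hΛη : 1 < Λ ^ η := Real.one_lt_rpow (by linarith) hη0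
  -- The three bounds give positivity of the Riesz factors, a main term beating the error, and the
  -- ball exponent d - η = s.
  set δ := min 1 (min (ε / (C + 1)) (Λ ^ η - 1)) with hδ
  have hδ0 : 0 < δ := lt_min one_pos (lt_min (by positivity) (by linarith))
  have hδ1 : δ ≤ 1 := min_le_left _ _
  have hδε : δ * (C + 1) ≤ ε := by
    rw [← le_div_iff₀ (by positivity)]
    exact (min_le_right _ _).trans (min_le_left _ _)
  have hδΛ : 1 + δ ≤ Λ ^ η := by
    have : δ ≤ Λ ^ η - 1 := (min_le_right _ _).trans (min_le_right _ _)
    linarith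
  -- Chosen so that w c conj a = |w|. Where w vanishes, division by zero gives a = 0, which is
  -- harmless.
  set a : ℕ → ℂ := fun j => w (m * j + r) * c (m * j + r) / ‖w (m * j + r)‖ with ha
  have ha1 : ∀ j, ‖a j‖ ≤ 1 := fun j => by
    simp only [ha, norm_div, norm_mul, hc, mul_one, Complex.norm_real, norm_norm]
    exact div_self_le_one _
  have hdis : ∀ j, 2 * ∑ i ∈ Finset.range j, ‖φ (ξ (m * i + r))‖ < ‖φ (ξ (m * j + r))‖ := by
    intro j
    simp_rw [hlac]
    rw [← Finset.mul_sum, Finset.range_eq_Ico]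
    have h1 := mul_le_mul_of_nonneg_left (sum_Ico_geom_le hm.le 0 j) hκ0.le
    have h2 : 0 < κ * Λ ^ j := by positivity
    linarith
  obtain ⟨μ, hμp, hμ1, hμ2, hμ3⟩ := exists_riesz_measure (φ := φ)
    (ξ := fun j => ξ (m * j + r)) hδ0.le hδ1 ha1 hdis
  obtain ⟨K, r₀, hK, hr₀, hball⟩ := exists_measure_closedBall_le hd hκ0 hm.le hlac
    (by positivity) hδΛ hη0.le (by rw [hη]; linarith [s.coe_nonneg]) hμ3
  refine le_dimH_of_measure_closedBall_le hK hr₀ (μ := μ) (fun y ρ h1 h2 => ?_) ?_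
  · simpa [hη] using hball y ρ h1 h2
  have hmean : ∀ n, ∫ x, mFourier k ((toralAffineMap B b)^[n] x) ∂μ =
      c n * ∫ x, mFourier (ξ n) x ∂μ := fun n => by
    simp_rw [hiter]
    exact integral_const_mul _ _
  refine measure_correlated_ne_zero hC (fun x => (norm_mFourier_apply k x).le)
    (fun n => (mFourier k).continuous.comp ((continuous_toralAffineMap B b).iterate n))
    -- Main term at least δ ε / 2, error at most δ² C / 4 ≤ δ ε / 4.
    (ε := δ * ε / 4) (by positivity) (hfreq.mono fun N hN => ?_)
  refine le_trans ?_ (norm_sum_ge_of_residue (m := m) (r := r) (δ := δ) hC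
    (fun n hn => ?_) (fun n hn => ?_) N)
  · have h1 : δ / 2 * ε ≤ δ / 2 *
        (1 / (N : ℝ) * ∑ n ∈ (Finset.range N).filter (· % m = r), ‖w n‖) := by gcongr
    nlinarith
  · obtain ⟨j, rfl⟩ : ∃ j, n = m * j + r := ⟨n / m, by rw [← hn, Nat.div_add_mod]⟩
    rw [hmean, hμ1]
    simp only [ha, map_div₀, map_mul, Complex.conj_ofReal]
    have hcc : c (m * j + r) * conj (c (m * j + r)) = 1 := by
      rw [Complex.mul_conj, Complex.normSq_eq_norm_sq, hc]; simp
    have hww : w (m * j + r) * conj (w (m * j + r)) = (‖w (m * j + r)‖ : ℂ) ^ 2 := by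
      rw [Complex.mul_conj, Complex.normSq_eq_norm_sq]; push_cast; ring
    rcases eq_or_ne (w (m * j + r)) 0 with h | h
    · simp [h]
    · have hne : (‖w (m * j + r)‖ : ℂ) ≠ 0 := by simpa using h
      push_cast
      field_simp
      linear_combination (δ : ℂ) * (w (m * j + r) * conj (w (m * j + r))) * hcc + (δ : ℂ) * hww
  · rw [hmean, norm_mul, hc, one_mul]
    -- |φ| is injective along the orbit and even, so a frequency off the class is not plus or minus
    -- one on it.
    have hne : ∀ j, ‖φ (ξ n)‖ ≠ ‖φ (ξ (m * j + r))‖ := by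
      intro j h
      rw [hφξ, hφξ] at h
      have := pow_right_injective₀ hz0 hz.ne' (mul_right_cancel₀ hφk.ne' h)
      exact hn (by rw [this, Nat.mul_add_mod, Nat.mod_eq_of_lt hrm])
    refine hμ2 _ (fun h => ?_) fun j => ⟨fun h => hne j (by rw [h]), fun h => hne j ?_⟩
    · have := hφξ n
      rw [h, map_zero, norm_zero] at this
      exact absurd this (by positivity)
    · rw [h, map_neg, norm_neg]

end

theorem theorem1p2 (d : ℕ) (B : Matrix (Fin d) (Fin d) ℤ) (hB : B.det ≠ 0) (b : Fin d → ℝ)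
    (hent : 0 < Dynamics.coverEntropy (toralAffineMap B b) Set.univ) :
    IsBohrChaotic (toralAffineMap B b) ∧
      ∀ w : ℕ → ℂ, IsWeight w → ∃ f : C(Torus d, ℂ),
        dimH {x : Torus d | IsCorrelatedPair (toralAffineMap B b) w f x} = d := by
  obtain ⟨z, u, hz, hu0, hu⟩ := exists_eigenvector_of_coverEntropy_pos B b hent
  obtain ⟨i, hi⟩ := Function.ne_iff.mp hu0
  have hd : 0 < d := i.pos
  have hk : freqFunctional u (Pi.single i 1) ≠ 0 := by
    simpa [freqFunctional, Pi.single_apply] using hi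
  have main := fun (w : ℕ → ℂ) (hw : IsWeight w) => dimH_correlated_eq b hz hu hk hd hw
  refine ⟨fun w hw => ⟨mFourier (Pi.single i 1), ?_⟩, fun w hw => ⟨_, main w hw⟩⟩
  -- A set of dimension d > 0 is non-empty, so Bohr chaos follows from the dimension statement.
  by_contra hcon
  have h := main w hw
  have hempty : {x | IsCorrelatedPair (toralAffineMap B b) w (mFourier (Pi.single i 1)) x} = ∅ :=
    Set.eq_empty_of_forall_notMem (not_exists.mp hcon)
  rw [hempty, dimH_empty] at h
  exact hd.ne (by exact_mod_cast h)
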